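/- Let $(M,g)$ be an oriented Riemannian manifold of dimension $n$ (smooth, Hausdorff) with a spin structure $\sigma:\mathrm{Spin}(M,g)\to \mathrm{SO}(M,g)$, let $\Sigma_n$ be an irreducible complex module of the Clifford algebra $\mathrm{Cl}_n$ (with the convention $v\cdot v=-|v|^2$), let $\rho$ be its restriction to $\mathrm{Spin}(n)$, and let $\Sigma M=\mathrm{Spin}(M,g)\times_\rho\Sigma_n$ be the spinor bundle. Let $p\in M$, identify $T_pM\cong\mathbb R^n$ by an oriented linear isometry, and let $\exp_p:U\to V$ be a diffeomorphism from an open neighbourhood $U$ of $0$ onto an open neighbourhood $V$ of $p$; let $x=(x^1,\dots,x^n)=\exp_p^{-1}:V\to U$ be the corresponding normal coordinates and $\partial_i=\partial/\partial x^i$. For $m\in V$ let $G_m=(g(\partial_i,\partial_j)(m))_{ij}$, let $B_m=(b_i^j(m))_{ij}$ be the unique symmetric positive definite matrix with $B_m^2=G_m^{-1}$, and let $(b^{-1})_l^k(m)$ be the coefficients of $B_m^{-1}$. Put $e_i=\sum_j b_i^j\,\partial_j$, an orthonormal frame of $TV$, and $\widetilde\Gamma^k_{ij}=g(\bar\nabla_{e_i}e_j,e_k)$,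 where $\bar\nabla$ is the Levi-Civita connection of $g$. The isometries $B_m:(\mathbb R^n,g_{\rm eucl})\to(T_mM,g_m)$, $(a^1,\dots,a^n)\mapsto\sum_{i,j}b_i^j(m)a^i\partial_j(m)$, act on frames and give an isomorphism $\eta:\mathrm{SO}(U,g_{\rm eucl})\to\mathrm{SO}(V,g)$ of principal bundles over $\exp_p$. Let $\bar\eta:\mathrm{Spin}(U,g_{\rm eucl})=U\times\mathrm{Spin}(n)\to\mathrm{Spin}(V,g)$ be a (smooth, $\mathrm{Spin}(n)$-equivariant) lift of $\eta$. For a spinor field $\psi=[s,\varphi]$ on $U$ let $\bar\psi=[\bar\eta(s),\varphi]$ be the corresponding spinor field on $V$. Let $\nabla$ be the flat connection on the spinor bundle $\Sigma U=\mathrm{Spin}(U,g_{\rm eucl})\times_\rho\Sigma_n$, and let $D$ and $\bar D$ be the Dirac operators of $(U,g_{\rm eucl})$ and $(V,g)$, acting on sections of $\Sigma U$ and $\Sigma V$. Then for every smooth $\psi\in\Gamma(\Sigma U)$, on all of $V$, $$\bar D\bar\psi=\overline{D\psi}+\mathbf W\cdot\bar\psi+\mathbf V\cdot\bar\psi+\sum_{i,j}(b_i^j-\delta_i^j)\,\overline{\partial_i\cdot\nabla_{\partial_j}\psi},$$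 where $\mathbf W\in\Gamma(\mathrm{Cl}\,TV)$ and $\mathbf V\in\Gamma(TV)$ are given by $$\mathbf W=\frac14\sum_{\substack{i,j,k\\ i\ne j\ne k\ne i}}\ \sum_{r,l} b_i^r\,(\partial_r b_j^l)\,(b^{-1})^k_l\; e_i\cdot e_j\cdot e_k,\qquad \mathbf V=\frac14\sum_{i,k}\Big(\widetilde\Gamma^i_{ik}-\widetilde\Gamma^k_{ii}\Big)e_k=\frac12\sum_{i,k}\widetilde\Gamma^i_{ik}\,e_k .$$ -/

import Mathlib

open scoped Manifold ContDiff Topology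
noncomputable section
namespace SpinGeometry

/-- Euclidean space `ℝⁿ`. -/
abbrev Euc (n : ℕ) := EuclideanSpace ℝ (Fin n)

/-- The standard basis of `ℝⁿ`. -/
def stdVec {n : ℕ} (i : Fin n) : Euc n := EuclideanSpace.single i 1

/-- The standard orientation of `ℝⁿ`. -/
def stdOrientation (n : ℕ) : Orientation ℝ (Euc n) (Fin n) :=
  (EuclideanSpace.basisFun (Fin n) ℝ).toBasis.orientation

/-- The quadratic form `v ↦ -|v|²`, so that `v · v = -|v|²` in the Clifford algebra. -/
def negForm (n : ℕ) : QuadraticForm ℝ (Euc n) := -LinearMap.BilinMap.toQuadraticMap (innerₗ (Euc n))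

lemma negForm_apply {n : ℕ} (v : Euc n) : negForm n v = -inner ℝ v v := rfl

/-- The real Clifford algebra `Cl_n`. -/
abbrev Cl (n : ℕ) := CliffordAlgebra (negForm n)

/-- The group `Spin(n)`. -/
abbrev Spin (n : ℕ) := spinGroup (negForm n)

abbrev vec {n : ℕ} : Euc n →ₗ[ℝ] Cl n := CliffordAlgebra.ι (negForm n)

lemma cl_nontrivial (n : ℕ) : Nontrivial (Cl n) := by
  have : Invertible (2 : ℝ) := invertibleOfNonzero two_ne_zero
  infer_instance

lemma vec_injective {n : ℕ} : Function.Injective (vec (n := n)) := by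
  have : Invertible (2 : ℝ) := invertibleOfNonzero two_ne_zero
  intro v w hvw
  have h : ∀ u, CliffordAlgebra.equivExterior (negForm n) (vec u) = ExteriorAlgebra.ι ℝ u :=
    fun u => CliffordAlgebra.changeForm_ι
      CliffordAlgebra.changeForm.associated_neg_proof u
  have := congrArg (CliffordAlgebra.equivExterior (negForm n)) hvw
  rw [h, h] at this
  exact ExteriorAlgebra.ι_leftInverse.injective this

lemma exists_conj {n : ℕ} (h : Spin n) (v : Euc n) :
    ∃ w : Euc n, vec w = (h : Cl n) * vec v * ((h⁻¹ : Spin n) : Cl n) := by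
  have : Invertible (2 : ℝ) := invertibleOfNonzero two_ne_zero
  obtain ⟨w, hw⟩ := spinGroup.conjAct_smul_ι_mem_range_ι
    (x := spinGroup.toUnits h) (by simp) v
  refine ⟨w, hw.trans ?_⟩
  rw [ConjAct.units_smul_def]
  rfl

lemma spin_inv_mul {n : ℕ} (h : Spin n) : ((h⁻¹ : Spin n) : Cl n) * (h : Cl n) = 1 :=
  spinGroup.coe_star_mul_self h

lemma spin_mul_inv {n : ℕ} (h : Spin n) : (h : Cl n) * ((h⁻¹ : Spin n) : Cl n) = 1 :=
  spinGroup.coe_mul_star_self h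

/-- The linear map `v ↦ h v h⁻¹` of `ℝⁿ`. -/
def adLin {n : ℕ} (h : Spin n) : Euc n →ₗ[ℝ] Euc n where
  toFun v := (exists_conj h v).choose
  map_add' v w := vec_injective <| by
    refine (exists_conj h (v + w)).choose_spec.trans (Eq.trans ?_ (map_add vec _ _).symm)
    refine Eq.trans ?_ (congrArg₂ (· + ·) (exists_conj h v).choose_spec
      (exists_conj h w).choose_spec).symm
    rw [map_add, mul_add, add_mul]
  map_smul' a v := vec_injective <| by
    refine (exists_conj h (a • v)).choose_spec.trans (Eq.trans ?_ (map_smul vec _ _).symm)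
    refine Eq.trans ?_ (congrArg (a • ·) (exists_conj h v).choose_spec).symm
    simp

lemma vec_adLin {n : ℕ} (h : Spin n) (v : Euc n) :
    vec (adLin h v) = (h : Cl n) * vec v * ((h⁻¹ : Spin n) : Cl n) :=
  (exists_conj h v).choose_spec

lemma adLin_mul {n : ℕ} (h k : Spin n) : adLin (h * k) = adLin h ∘ₗ adLin k := by
  ext1 v
  apply vec_injective
  simp only [LinearMap.comp_apply, vec_adLin, mul_inv_rev, Submonoid.coe_mul, mul_assoc]

lemma adLin_one {n : ℕ} : adLin (1 : Spin n) = LinearMap.id := by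
  ext1 v
  apply vec_injective
  simp [vec_adLin]

/-- The double covering `Ad : Spin(n) → SO(n)`, `Ad(h) v = h v h⁻¹`. -/
def Ad {n : ℕ} (h : Spin n) : Euc n ≃ₗ[ℝ] Euc n :=
  LinearEquiv.ofLinearMap (adLin h) (adLin h⁻¹)
    (by rw [← adLin_mul, mul_inv_cancel, adLin_one])
    (by rw [← adLin_mul, inv_mul_cancel, adLin_one])

lemma vec_Ad {n : ℕ} (h : Spin n) (v : Euc n) :
    vec (Ad h v) = (h : Cl n) * vec v * ((h⁻¹ : Spin n) : Cl n) := vec_adLin h v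

lemma Ad_one {n : ℕ} (v : Euc n) : Ad (1 : Spin n) v = v :=
  congrArg (fun f => f v) (adLin_one (n := n))

lemma Ad_mul {n : ℕ} (h k : Spin n) (v : Euc n) : Ad (h * k) v = Ad h (Ad k v) :=
  congrArg (fun f => f v) (adLin_mul h k)

lemma inner_Ad_self {n : ℕ} (h : Spin n) (v : Euc n) :
    inner ℝ (Ad h v) (Ad h v) = inner ℝ v v := by
  have h1 := CliffordAlgebra.ι_sq_scalar (negForm n) (Ad h v)
  have h2 := CliffordAlgebra.ι_sq_scalar (negForm n) v
  have h3 : vec (Ad h v) * vec (Ad h v)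
      = algebraMap ℝ (Cl n) (negForm n v) := by
    rw [vec_Ad]
    calc _ = (h : Cl n) * (vec v * (((h⁻¹ : Spin n) : Cl n) * (h : Cl n)) * vec v)
          * ((h⁻¹ : Spin n) : Cl n) := by simp only [mul_assoc]
      _ = algebraMap ℝ (Cl n) (negForm n v) := by
          rw [spin_inv_mul, mul_one, h2, ← Algebra.commutes, mul_assoc, spin_mul_inv, mul_one]
  rw [h1] at h3
  have := cl_nontrivial n
  have := (algebraMap ℝ (Cl n)).injective h3
  rw [negForm_apply, negForm_apply] at this
  linarith

lemma inner_Ad {n : ℕ} (h : Spin n) (v w : Euc n) :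
    inner ℝ (Ad h v) (Ad h w) = inner ℝ v w := by
  have := inner_Ad_self h (v + w)
  have hv := inner_Ad_self h v
  have hw := inner_Ad_self h w
  rw [map_add, real_inner_add_add_self, real_inner_add_add_self, hv, hw] at this
  linarith

/-- A product of `k` vectors acts by twisted conjugation with determinant `(-1)ᵏ`. -/
def Twisted {n : ℕ} (x : (Cl n)ˣ) : Prop :=
  ∃ k : ℕ, (x : Cl n) ∈ CliffordAlgebra.evenOdd (negForm n) (k : ZMod 2) ∧
    ∃ f : Euc n →ₗ[ℝ] Euc n, LinearMap.det f = (-1) ^ k ∧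
      ∀ v, vec (f v) = CliffordAlgebra.involute (x : Cl n) * vec v * ((x⁻¹ : (Cl n)ˣ) : Cl n)

lemma twisted_vec {n : ℕ} (x : (Cl n)ˣ) (a : Euc n) (hx : vec a = (x : Cl n)) : Twisted x := by
  have ha : a ≠ 0 := by
    rintro rfl
    rw [map_zero] at hx
    have := cl_nontrivial n
    exact x.ne_zero hx.symm
  have haa : inner ℝ a a ≠ 0 := inner_self_ne_zero.mpr ha
  refine ⟨1, by rw [← hx]; exact CliffordAlgebra.ι_mem_evenOdd_one _ a,
    ((ℝ ∙ a)ᗮ.reflection).toLinearEquiv.toLinearMap, ?_, ?_⟩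
  · have := (ℝ ∙ a)ᗮ.det_reflection
    rw [Submodule.orthogonal_orthogonal, finrank_span_singleton ha] at this
    exact this
  · intro v
    rw [Units.eq_mul_inv_iff_mul_eq]
    rw [← hx, CliffordAlgebra.involute_ι]
    have : ((ℝ ∙ a)ᗮ.reflection).toLinearEquiv.toLinearMap v
        = v - (2 * (inner ℝ a v / inner ℝ a a)) • a := by
      have := Submodule.reflection_orthogonal_apply (K := (ℝ ∙ a)) v
      change (ℝ ∙ a)ᗮ.reflection v = _
      rw [this, Submodule.reflection_singleton_apply]
      rw [RCLike.ofReal_real_eq_id, id_eq, ← real_inner_self_eq_norm_sq, two_smul, mul_smul,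
        two_smul]
      abel
    rw [this]
    have h1 : vec v * vec a = - (vec a * vec v) + algebraMap ℝ (Cl n) (-(2 * inner ℝ a v)) := by
      have := CliffordAlgebra.ι_mul_ι_add_swap (Q := negForm n) v a
      rw [eq_neg_add_iff_add_eq, add_comm, this]
      congr 1
      simp only [QuadraticMap.polar, negForm_apply, real_inner_add_add_self,
        real_inner_comm]
      ring
    rw [map_sub, map_smul, sub_mul, h1, smul_mul_assoc, CliffordAlgebra.ι_sq_scalar,
      negForm_apply, Algebra.smul_def, ← map_mul (algebraMap ℝ (Cl n))]
    have : 2 * (inner ℝ a v / inner ℝ a a) * -inner ℝ a a = -(2 * inner ℝ a v) := by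
      field_simp
    rw [this]
    simp

lemma twisted_of_mem {n : ℕ} (x : (Cl n)ˣ) (hx : x ∈ lipschitzGroup (negForm n)) :
    Twisted x := by
  unfold lipschitzGroup at hx
  induction hx using Subgroup.closure_induction'' with
  | mem x hx =>
    obtain ⟨a, ha⟩ := hx
    exact twisted_vec x a ha
  | inv_mem x hx =>
    obtain ⟨a, ha⟩ := hx
    have hu : (x : Cl n) * (x : Cl n) = algebraMap ℝ (Cl n) (negForm n a) := by
      rw [← ha]; exact CliffordAlgebra.ι_sq_scalar _ a
    have hQ : negForm n a ≠ 0 := by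
      intro h0
      rw [h0, map_zero] at hu
      have := cl_nontrivial n
      exact (x * x).ne_zero hu
    refine twisted_vec x⁻¹ ((negForm n a)⁻¹ • a) ?_
    rw [← mul_one ((x⁻¹ : (Cl n)ˣ) : Cl n), Units.eq_inv_mul_iff_mul_eq, map_smul, ha,
      mul_smul_comm, hu, Algebra.smul_def, ← map_mul, inv_mul_cancel₀ hQ, map_one]
  | one => exact ⟨0, by exact (CliffordAlgebra.even (negForm n)).one_mem,
      LinearMap.id, by simp, by simp⟩
  | mul x y _ _ hx hy =>
    obtain ⟨k, hk, f, hf, hf'⟩ := hx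
    obtain ⟨l, hl, g, hg, hg'⟩ := hy
    refine ⟨k + l, ?_, f ∘ₗ g, by rw [LinearMap.det_comp, hf, hg, pow_add], ?_⟩
    · rw [Nat.cast_add, Units.val_mul]
      exact SetLike.mul_mem_graded hk hl
    · intro v
      rw [LinearMap.comp_apply, hf', hg']
      simp only [Units.val_mul, map_mul, mul_inv_rev, mul_assoc]

lemma det_Ad {n : ℕ} (h : Spin n) : LinearMap.det (Ad h : Euc n →ₗ[ℝ] Euc n) = 1 := by
  have hmem : (spinGroup.toUnits h : (Cl n)ˣ) ∈ lipschitzGroup (negForm n) :=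
    spinGroup.units_mem_lipschitzGroup (by simp)
  obtain ⟨k, hk, f, hf, hf'⟩ := twisted_of_mem _ hmem
  have hfe : f = (Ad h : Euc n →ₗ[ℝ] Euc n) := by
    ext1 v
    apply vec_injective
    rw [hf']
    refine Eq.trans ?_ (vec_Ad h v).symm
    rw [show ((spinGroup.toUnits h : (Cl n)ˣ) : Cl n) = h from rfl, spinGroup.involute_eq h.2]
    rfl
  rw [← hfe, hf]
  rcases Nat.even_or_odd k with hk' | hk'
  · exact hk'.neg_one_pow
  · exfalso
    have h0 : (h : Cl n) ∈ CliffordAlgebra.evenOdd (negForm n) 0 := spinGroup.mem_even h.2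
    have h1 : (h : Cl n) ∈ CliffordAlgebra.evenOdd (negForm n) 1 := by
      have : (k : ZMod 2) = 1 := (ZMod.natCast_eq_one_iff_odd).mpr hk'
      rw [this] at hk
      exact hk
    have h2 : (h : Cl n) = 0 := (Submodule.disjoint_def.mp
      (CliffordAlgebra.evenOdd_isCompl (Q := negForm n)).disjoint) _ h0 h1
    have := cl_nontrivial n
    exact (spinGroup.toUnits h).ne_zero h2

lemma map_Ad_orientation {n : ℕ} (h : Spin n) :
    Orientation.map (Fin n) (Ad h) (stdOrientation n) = stdOrientation n := by
  rw [Orientation.map_eq_iff_det_pos _ _ (by simp), det_Ad]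
  exact one_pos

/-! ### Riemannian geometry -/

section Geometry

variable {n : ℕ} {M : Type*} [TopologicalSpace M] [ChartedSpace (Euc n) M]

/-- The tangent space `T_xM`. -/
abbrev Tan (n : ℕ) {M : Type*} [TopologicalSpace M] [ChartedSpace (Euc n) M] (x : M) :=
  TangentSpace 𝓘(ℝ, Euc n) x

/-- (Not necessarily continuous) vector fields on `M`. -/
abbrev VField (n : ℕ) (M : Type*) [TopologicalSpace M] [ChartedSpace (Euc n) M] :=
  ∀ x : M, Tan n x

/-- Smoothness of a vector field on a subset. -/
def SmoothVFieldOn [IsManifold 𝓘(ℝ, Euc n) ∞ M] (X : VField n M) (W : Set M) : Prop :=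
  ContMDiffOn 𝓘(ℝ, Euc n) 𝓘(ℝ, Euc n).tangent ∞
    (fun x => (⟨x, X x⟩ : TangentBundle 𝓘(ℝ, Euc n) M)) W

/-- Smooth Riemannian metrics on `M`. -/
abbrev Metric (n : ℕ) (M : Type*) [TopologicalSpace M] [ChartedSpace (Euc n) M]
    [IsManifold 𝓘(ℝ, Euc n) ∞ M] :=
  Bundle.ContMDiffRiemannianMetric 𝓘(ℝ, Euc n) ∞ (Euc n) (fun x : M => Tan n x)

/-- An orientation of `M`: a locally constant choice of orientations of the tangent spaces. -/
structure OrientationField (n : ℕ) (M : Type*) [TopologicalSpace M] [ChartedSpace (Euc n) M]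
    [IsManifold 𝓘(ℝ, Euc n) ∞ M] where
  at_ : ∀ x : M, Orientation ℝ (Tan n x) (Fin n)
  locally_const : ∀ x : M, ∀ᶠ y in 𝓝 x,
    ∀ hy : y ∈ (trivializationAt (Euc n) (TangentSpace 𝓘(ℝ, Euc n) (M := M)) x).baseSet,
      Orientation.map (Fin n)
        ((trivializationAt (Euc n) (TangentSpace 𝓘(ℝ, Euc n) (M := M)) x).linearEquivAt ℝ y hy)
        (at_ y) =
      Orientation.map (Fin n)
        ((trivializationAt (Euc n) (TangentSpace 𝓘(ℝ, Euc n) (M := M)) x).linearEquivAt ℝ x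
          (FiberBundle.mem_baseSet_trivializationAt' x))
        (at_ x)

variable [IsManifold 𝓘(ℝ, Euc n) ∞ M]

/-- The fibre `SO(M,g)_x`: positively oriented orthonormal frames of `T_xM`, regarded as
orientation preserving linear isometries `ℝⁿ → T_xM`. -/
structure OrthoFrame (g : Metric n M) (o : OrientationField n M) (x : M) where
  toLin : Euc n ≃ₗ[ℝ] Tan n x
  isometry : ∀ v w, g.inner x (toLin v) (toLin w) = inner ℝ v w
  oriented : Orientation.map (Fin n) toLin (stdOrientation n) = o.at_ x

/-- The Koszul expression: for the Levi-Civita connection `∇` of `g` and differentiable vector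
fields, `koszul g X Y Z x = g(∇_X Y, Z)(x)`. -/
def koszul (g : Metric n M) (X Y Z : VField n M) (x : M) : ℝ :=
  (1 / 2 : ℝ) *
    (mvfderiv 𝓘(ℝ, Euc n) (fun y => g.inner y (Y y) (Z y)) x (X x)
    + mvfderiv 𝓘(ℝ, Euc n) (fun y => g.inner y (Z y) (X y)) x (Y x)
    - mvfderiv 𝓘(ℝ, Euc n) (fun y => g.inner y (X y) (Y y)) x (Z x)
    + g.inner x (VectorField.mlieBracket 𝓘(ℝ, Euc n) X Y x) (Z x)
    - g.inner x (VectorField.mlieBracket 𝓘(ℝ, Euc n) Y Z x) (X x)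
    + g.inner x (VectorField.mlieBracket 𝓘(ℝ, Euc n) Z X x) (Y x))

/-- The metric in the preferred chart at `x₀`, as a function of a point `y` of the chart domain
in `ℝⁿ` and two vectors. -/
def chartMetric (g : Metric n M) (x₀ : M) (y u v : Euc n) : ℝ :=
  g.inner ((extChartAt 𝓘(ℝ, Euc n) x₀).symm y)
    (mfderiv 𝓘(ℝ, Euc n) 𝓘(ℝ, Euc n) (extChartAt 𝓘(ℝ, Euc n) x₀).symm y u)
    (mfderiv 𝓘(ℝ, Euc n) 𝓘(ℝ, Euc n) (extChartAt 𝓘(ℝ, Euc n) x₀).symm y v)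

/-- Christoffel symbols with lowered index,
`Γ(u,v;w) = ½ (∂_u G(v,w) + ∂_v G(u,w) - ∂_w G(u,v))`, of a metric `G` on an open set of `ℝⁿ`. -/
def loweredChristoffel (G : Euc n → Euc n → Euc n → ℝ) (y u v w : Euc n) : ℝ :=
  (1 / 2 : ℝ) * (fderiv ℝ (fun z => G z v w) y u + fderiv ℝ (fun z => G z u w) y v
    - fderiv ℝ (fun z => G z u v) y w)

/-- `γ` is a geodesic on the open set `J`: it is smooth and in the chart at each of its points it
satisfies the geodesic equation `G(c'', w) + Γ(c', c'; w) = 0` for all `w`. -/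
def IsGeodesicOn (g : Metric n M) (γ : ℝ → M) (J : Set ℝ) : Prop :=
  ContMDiffOn 𝓘(ℝ, ℝ) 𝓘(ℝ, Euc n) ∞ γ J ∧
  ∀ t ∈ J, ∀ w : Euc n,
    let c : ℝ → Euc n := fun s => extChartAt 𝓘(ℝ, Euc n) (γ t) (γ s)
    chartMetric g (γ t) (c t) (deriv (deriv c) t) w
      + loweredChristoffel (chartMetric g (γ t)) (c t) (deriv c t) (deriv c t) w = 0

/-- `exp_p` is defined at `v` and `exp_p v = q`: there is a geodesic defined on a neighbourhood of
`[0,1]` with initial point `p`, initial velocity `v` and `γ 1 = q`. -/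
def IsExp (g : Metric n M) (p : M) (v : Tan n p) (q : M) : Prop :=
  ∃ (γ : ℝ → M) (J : Set ℝ), IsOpen J ∧ Set.Icc 0 1 ⊆ J ∧ IsGeodesicOn g γ J ∧
    (⟨γ 0, mfderiv 𝓘(ℝ, ℝ) 𝓘(ℝ, Euc n) γ 0 (1 : ℝ)⟩ : TangentBundle 𝓘(ℝ, Euc n) M) = ⟨p, v⟩ ∧
    γ 1 = q

/-- Riemannian normal coordinates at `p`: `exp_p` restricts to a diffeomorphism from a
neighbourhood `U` of `0` in `T_pM ≅ ℝⁿ` onto a neighbourhood `V` of `p`. The coordinate map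
`coord : V → U` is its inverse. The identification `ℝⁿ ≅ T_pM` is an oriented isometry. -/
structure NormalCoordinates (g : Metric n M) (o : OrientationField n M) (p : M) where
  frame : OrthoFrame g o p
  coord : OpenPartialHomeomorph M (Euc n)
  smooth_coord : ContMDiffOn 𝓘(ℝ, Euc n) 𝓘(ℝ, Euc n) ∞ coord coord.source
  smooth_symm : ContMDiffOn 𝓘(ℝ, Euc n) 𝓘(ℝ, Euc n) ∞ coord.symm coord.target
  zero_mem : (0 : Euc n) ∈ coord.target
  exp_eq : ∀ v ∈ coord.target, IsExp g p (frame.toLin v) (coord.symm v)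

/-! ### Spin structures and spinors -/

/-- Smoothness on `W` of a map with values in the finite-dimensional vector space `Cl_n`:
all linear functionals of it are smooth. -/
def SmoothClOn (n : ℕ) {M : Type*} [TopologicalSpace M] [ChartedSpace (Euc n) M]
    (f : M → Cl n) (W : Set M) : Prop :=
  ∀ l : Cl n →ₗ[ℝ] ℝ, ContMDiffOn 𝓘(ℝ, Euc n) 𝓘(ℝ, ℝ) ∞ (fun x => l (f x)) W

/-- A spin structure on the oriented Riemannian manifold `(M,g)`: a smooth principal
`Spin(n)`-bundle `P = Spin(M,g)` together with a smooth bundle map `σ : P → SO(M,g)` over the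
identity such that `σ(p·h) = σ(p) ∘ Ad(h)`. The smooth bundle `P` is given by its fibres `P x`, on
which `Spin(n)` acts simply transitively from the right, and by a preferred local section
(a local trivialization) near every point, with smooth transition functions. -/
structure SpinStructure (g : Metric n M) (o : OrientationField n M) where
  P : M → Type*
  act : ∀ {x}, P x → Spin n → P x
  act_one : ∀ {x} (p : P x), act p 1 = p
  act_mul : ∀ {x} (p : P x) (h k : Spin n), act p (h * k) = act (act p h) k
  simply_transitive : ∀ {x} (p q : P x), ∃! h : Spin n, act p h = q
  σ : ∀ {x}, P x → OrthoFrame g o x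
  σ_act : ∀ {x} (p : P x) (h : Spin n) (v : Euc n), (σ (act p h)).toLin v = (σ p).toLin (Ad h v)
  /-- The domain of the preferred local section at a point. -/
  dom : M → Set M
  isOpen_dom : ∀ x, IsOpen (dom x)
  mem_dom : ∀ x, x ∈ dom x
  /-- The preferred local section at a point; only its values on the domain matter. -/
  sec : M → ∀ y, P y
  smooth_frame : ∀ (x : M) (v : Euc n), SmoothVFieldOn (fun y => (σ (sec x y)).toLin v) (dom x)
  smooth_transition : ∀ (x x' : M) (h : M → Spin n),
    (∀ y ∈ dom x ∩ dom x', sec x' y = act (sec x y) (h y)) →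
      SmoothClOn n (fun y => (h y : Cl n)) (dom x ∩ dom x')

/-- A complex spinor module `Σ_n`: an irreducible complex representation of `Cl_n`. Its restriction
to `Spin(n) ⊆ Cl_n` is the complex spinor representation `ρ`. -/
structure SpinorModule (n : ℕ) (S : Type*) [NormedAddCommGroup S] [NormedSpace ℂ S] where
  c : Cl n →ₐ[ℝ] Module.End ℂ S
  nontrivial : Nontrivial S
  irreducible : ∀ N : Submodule ℂ S, (∀ a : Cl n, ∀ φ ∈ N, c a φ ∈ N) → N = ⊥ ∨ N = ⊤

variable {g : Metric n M} {o : OrientationField n M}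
  {S : Type*} [NormedAddCommGroup S] [NormedSpace ℂ S]

/-- `(p·h, ρ(h)⁻¹φ) ∼ (p, φ)`. -/
def spinorRel (s : SpinStructure g o) (ρ : SpinorModule n S) (x : M) :
    Setoid (s.P x × S) where
  r a b := ∃ h : Spin n, b.1 = s.act a.1 h ∧ b.2 = ρ.c ((h⁻¹ : Spin n) : Cl n) a.2
  iseqv :=
    { refl := fun a => ⟨1, (s.act_one _).symm, by simp⟩
      symm := by
        rintro a b ⟨h, h1, h2⟩
        refine ⟨h⁻¹, ?_, ?_⟩
        · rw [h1, ← s.act_mul, mul_inv_cancel, s.act_one]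
        · rw [h2, inv_inv, ← Module.End.mul_apply, ← map_mul, spin_mul_inv, map_one,
            Module.End.one_apply]
      trans := by
        rintro a b d ⟨h, h1, h2⟩ ⟨k, k1, k2⟩
        refine ⟨h * k, ?_, ?_⟩
        · rw [k1, h1, s.act_mul]
        · rw [k2, h2, mul_inv_rev, ← Module.End.mul_apply, ← map_mul, Submonoid.coe_mul] }

/-- The fibre at `x` of the spinor bundle `ΣM = Spin(M,g) ×_ρ Σ_n`. -/
def Spinor (s : SpinStructure g o) (ρ : SpinorModule n S) (x : M) : Type _ :=
  Quotient (spinorRel s ρ x)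

/-- The class `[p, φ]`. -/
def Spinor.mk (s : SpinStructure g o) (ρ : SpinorModule n S) {x : M} (p : s.P x) (φ : S) :
    Spinor s ρ x := Quotient.mk (spinorRel s ρ x) (p, φ)

variable (s : SpinStructure g o) (ρ : SpinorModule n S)

lemma Spinor.mk_act {x : M} (p : s.P x) (h : Spin n) (φ : S) :
    Spinor.mk s ρ (s.act p h) φ = Spinor.mk s ρ p (ρ.c (h : Cl n) φ) := by
  refine (Quotient.sound ⟨h, rfl, ?_⟩ : Spinor.mk s ρ p (ρ.c (h : Cl n) φ) = _).symm
  rw [← Module.End.mul_apply, ← map_mul, spin_inv_mul, map_one, Module.End.one_apply]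

lemma Spinor.mk_bijective {x : M} (p : s.P x) : Function.Bijective (Spinor.mk s ρ p) := by
  constructor
  · intro φ χ h
    obtain ⟨k, h1, h2⟩ := Quotient.exact h
    have hk : k = 1 := (s.simply_transitive p p).unique h1.symm (s.act_one p)
    subst hk
    simpa using h2.symm
  · intro a
    induction a using Quotient.inductionOn with
    | h a =>
      obtain ⟨q, φ⟩ := a
      obtain ⟨h, rfl, -⟩ := s.simply_transitive p q
      exact ⟨ρ.c (h : Cl n) φ, (Spinor.mk_act s ρ p h φ).symm⟩

/-- For `p ∈ P_x` the bijection `φ ↦ [p, φ]` from `Σ_n` to the fibre `Σ_xM`. -/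
def Spinor.equiv {x : M} (p : s.P x) : S ≃ Spinor s ρ x :=
  Equiv.ofBijective _ (Spinor.mk_bijective s ρ p)

/-- The vector space structure on `Σ_xM` for which all maps `φ ↦ [p, φ]` are linear. -/
instance (x : M) : AddCommGroup (Spinor s ρ x) :=
  (Spinor.equiv s ρ (s.sec x x)).symm.addCommGroup

instance (x : M) : Module ℂ (Spinor s ρ x) :=
  (Spinor.equiv s ρ (s.sec x x)).symm.module ℂ

/-- The linear isomorphism `φ ↦ [p, φ]` for `p` in the preferred section. -/
def Spinor.linEquiv₀ (x : M) : S ≃ₗ[ℂ] Spinor s ρ x :=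
  ((Spinor.equiv s ρ (s.sec x x)).symm.linearEquiv ℂ).symm

lemma Spinor.mk_sec (x : M) (φ : S) :
    Spinor.mk s ρ (s.sec x x) φ = Spinor.linEquiv₀ s ρ x φ := rfl

lemma Spinor.mk_eq {x : M} (h : Spin n) (φ : S) :
    Spinor.mk s ρ (s.act (s.sec x x) h) φ = Spinor.linEquiv₀ s ρ x (ρ.c (h : Cl n) φ) :=
  Spinor.mk_act s ρ _ h φ

/-- The linear isomorphism `φ ↦ [p, φ]` from `Σ_n` to `Σ_xM`. -/
def Spinor.linEquiv {x : M} (p : s.P x) : S ≃ₗ[ℂ] Spinor s ρ x where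
  toEquiv := Spinor.equiv s ρ p
  map_add' φ χ := by
    obtain ⟨h, rfl, -⟩ := s.simply_transitive (s.sec x x) p
    change Spinor.mk s ρ _ _ = Spinor.mk s ρ _ _ + Spinor.mk s ρ _ _
    simp only [Spinor.mk_eq, map_add]
  map_smul' a φ := by
    obtain ⟨h, rfl, -⟩ := s.simply_transitive (s.sec x x) p
    change Spinor.mk s ρ _ _ = a • Spinor.mk s ρ _ _
    simp only [Spinor.mk_eq, map_smul]

lemma Spinor.linEquiv_apply {x : M} (p : s.P x) (φ : S) :
    Spinor.linEquiv s ρ p φ = Spinor.mk s ρ p φ := rfl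

/-- Clifford multiplication by tangent vectors: `X · [p, φ] = [p, σ(p)⁻¹(X) · φ]`. It is computed
here with `p` in the preferred section, see `cliffordMul_mk` for arbitrary `p`. -/
def cliffordMul (x : M) : Tan n x →ₗ[ℝ] Module.End ℂ (Spinor s ρ x) where
  toFun X := (Spinor.linEquiv s ρ (s.sec x x)).toLinearMap ∘ₗ
    ρ.c (vec ((s.σ (s.sec x x)).toLin.symm X)) ∘ₗ
    (Spinor.linEquiv s ρ (s.sec x x)).symm.toLinearMap
  map_add' X Y := by ext1 a; simp
  map_smul' r X := by
    ext1 a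
    simp only [map_smul, LinearMap.comp_apply, LinearMap.smul_apply, RingHom.id_apply,
      LinearEquiv.coe_coe]
    exact ((Spinor.linEquiv s ρ (s.sec x x)).toLinearMap.restrictScalars ℝ).map_smul r _

lemma cliffordMul_mk {x : M} (X : Tan n x) (p : s.P x) (φ : S) :
    cliffordMul s ρ x X (Spinor.mk s ρ p φ)
      = Spinor.mk s ρ p (ρ.c (vec ((s.σ p).toLin.symm X)) φ) := by
  obtain ⟨h, rfl, -⟩ := s.simply_transitive (s.sec x x) p
  have hX : (s.σ (s.sec x x)).toLin.symm X
      = Ad h ((s.σ (s.act (s.sec x x) h)).toLin.symm X) := by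
    rw [LinearEquiv.symm_apply_eq, ← s.σ_act, LinearEquiv.apply_symm_apply]
  rw [Spinor.mk_act, Spinor.mk_act, ← Spinor.linEquiv_apply, ← Spinor.linEquiv_apply]
  change Spinor.linEquiv s ρ (s.sec x x) (ρ.c (vec ((s.σ (s.sec x x)).toLin.symm X))
    ((Spinor.linEquiv s ρ (s.sec x x)).symm (Spinor.linEquiv s ρ (s.sec x x) _))) = _
  rw [LinearEquiv.symm_apply_apply, hX, vec_Ad, ← Module.End.mul_apply, ← Module.End.mul_apply,
    ← map_mul, ← map_mul, mul_assoc, spin_inv_mul, mul_one]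

/-- The quadratic form `X ↦ -g(X,X)` on `T_xM`. -/
def tanForm (g : Metric n M) (x : M) : QuadraticForm ℝ (Tan n x) :=
  -LinearMap.BilinMap.toQuadraticMap
    (LinearMap.mk₂ ℝ (fun X Y : Tan n x => g.inner x X Y)
      (by intros; simp) (by intros; simp) (by intros; simp) (by intros; simp))

/-- The fibre `Cl(T_xM)` of the Clifford bundle `Cl TM`. -/
abbrev ClTan (g : Metric n M) (x : M) := CliffordAlgebra (tanForm g x)

/-- The action of `Cl(T_xM)` on `Σ_xM` extending Clifford multiplication by vectors. -/
def cliffordAction (x : M) : ClTan g x →ₐ[ℝ] Module.End ℂ (Spinor s ρ x) :=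
  CliffordAlgebra.lift (tanForm g x) ⟨cliffordMul s ρ x, by
    intro X
    ext1 a
    obtain ⟨φ, rfl⟩ := (Spinor.mk_bijective s ρ (s.sec x x)).2 a
    rw [Module.End.mul_apply, cliffordMul_mk, cliffordMul_mk, ← Module.End.mul_apply, ← map_mul,
      CliffordAlgebra.ι_sq_scalar, negForm_apply, ← (s.σ (s.sec x x)).isometry,
      LinearEquiv.apply_symm_apply, AlgHom.commutes]
    exact ((Spinor.linEquiv s ρ (s.sec x x)).toLinearMap.restrictScalars ℝ).map_smul _ _⟩

/-! ### The spinorial Levi-Civita connection and the Dirac operator -/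

/-- (Not necessarily continuous) spinor fields. -/
abbrev SpinorField (s : SpinStructure g o) (ρ : SpinorModule n S) := ∀ x, Spinor s ρ x

/-- The function `φ` with `ψ = [q, φ]`, where `q` is a section of `P`. -/
def component (q : ∀ y, s.P y) (ψ : SpinorField s ρ) : M → S :=
  fun y => (Spinor.linEquiv s ρ (q y)).symm (ψ y)

/-- Smoothness of a spinor field on `W`. -/
def SmoothSpinorOn (ψ : SpinorField s ρ) (W : Set M) : Prop :=
  ∀ x, ContMDiffOn 𝓘(ℝ, Euc n) 𝓘(ℝ, S) ∞ (component s ρ (s.sec x) ψ) (W ∩ s.dom x)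

/-- The orthonormal frame `e_1, …, e_n` underlying a section `q` of `P`. -/
def frameField (q : ∀ y, s.P y) (i : Fin n) : VField n M := fun y => (s.σ (q y)).toLin (stdVec i)

/-- The lift to the spinor bundle of the Levi-Civita connection, in the local section `q` of `P`
with underlying orthonormal frame `e_1, …, e_n`:
`∇_X [q, φ] = [q, ∂_X φ + ¼ ∑_{j,k} g(∇_X e_j, e_k) E_j · E_k · φ]`. -/
def spinorNablaIn (q : ∀ y, s.P y) (X : VField n M) (ψ : SpinorField s ρ) : SpinorField s ρ :=
  fun x => Spinor.mk s ρ (q x)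
    (mvfderiv 𝓘(ℝ, Euc n) (component s ρ q ψ) x (X x)
      + (1 / 4 : ℝ) • ∑ j, ∑ k, koszul g X (frameField s q j) (frameField s q k) x •
          ρ.c (vec (stdVec j) * vec (stdVec k)) (component s ρ q ψ x))

/-- The spinorial Levi-Civita connection `∇_X ψ`. At a point `x` it is computed in the preferred
local section at `x` (the value does not depend on the local section). -/
def spinorNabla (X : VField n M) (ψ : SpinorField s ρ) : SpinorField s ρ :=
  fun x => spinorNablaIn s ρ (s.sec x) X ψ x

/-- The Dirac operator `Dψ = ∑_i e_i · ∇_{e_i} ψ`. At a point `x` it is computed with the orthonormal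
frame underlying the preferred local section at `x` (the value does not depend on the frame). -/
def dirac (ψ : SpinorField s ρ) : SpinorField s ρ :=
  fun x => ∑ i, cliffordMul s ρ x (frameField s (s.sec x) i x)
    (spinorNabla s ρ (frameField s (s.sec x) i) ψ x)

end Geometry

/-! ### Flat space -/

/-- The Euclidean metric on `ℝⁿ`. -/
def flatMetric (n : ℕ) : Metric n (Euc n) where
  inner := (riemannianMetricVectorSpace (Euc n)).inner
  symm := (riemannianMetricVectorSpace (Euc n)).symm
  pos := (riemannianMetricVectorSpace (Euc n)).pos
  isVonNBounded := (riemannianMetricVectorSpace (Euc n)).isVonNBounded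
  contMDiff := (riemannianMetricVectorSpace (Euc n)).contMDiff.of_le (by simp)

/-- The constant vector field with value `v` on `ℝⁿ`. -/
def constField {n : ℕ} (v : Euc n) : VField n (Euc n) := fun _ => v

/-- The standard orientation of the manifold `ℝⁿ`. -/
def flatOrientation (n : ℕ) : OrientationField n (Euc n) where
  at_ _ := stdOrientation n
  locally_const x := by
    refine Filter.Eventually.of_forall fun y hy => ?_
    have h : ∀ (z : Euc n)
        (hz : z ∈ (trivializationAt (Euc n) (TangentSpace 𝓘(ℝ, Euc n) (M := Euc n)) x).baseSet),
        ((trivializationAt (Euc n) (TangentSpace 𝓘(ℝ, Euc n) (M := Euc n)) x).linearEquivAt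
          ℝ z hz) = LinearEquiv.refl ℝ (Euc n) := by
      intro z hz
      ext1 v
      have := TangentBundle.continuousLinearMapAt_model_space (𝕜 := ℝ) x z
      have h2 := congrArg (fun f => f v) this
      refine Eq.trans ?_ h2
      rw [Bundle.Trivialization.continuousLinearMapAt_apply,
        Bundle.Trivialization.coe_linearMapAt_of_mem _ hz]
      rfl
    rw [h y hy, h x]
    rfl

/-- The trivial spin structure `Spin(ℝⁿ, g_eucl) = ℝⁿ × Spin(n)`. -/
def flatSpin (n : ℕ) : SpinStructure (flatMetric n) (flatOrientation n) where
  P _ := Spin n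
  act p h := p * h
  act_one := mul_one
  act_mul p h k := (mul_assoc p h k).symm
  simply_transitive p q := ⟨p⁻¹ * q, by simp, by rintro h rfl; simp⟩
  σ p := ⟨Ad p, inner_Ad p, map_Ad_orientation p⟩
  σ_act p h v := Ad_mul p h v
  dom _ := Set.univ
  isOpen_dom _ := isOpen_univ
  mem_dom _ := Set.mem_univ _
  sec _ _ := 1
  smooth_frame x v := by
    refine ContMDiff.contMDiffOn ?_
    intro y
    rw [Bundle.contMDiffAt_section]
    convert! contMDiffAt_const (c := Ad (1 : Spin n) v)
    simp [TangentSpace]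
    rfl
  smooth_transition x x' h hh l := by
    have : ∀ y, h y = 1 := fun y => by simpa using (hh y ⟨trivial, trivial⟩).symm
    simp only [this]
    exact contMDiffOn_const

/-! ### The Bourguignon–Gauduchon trivialization -/

section BG

open scoped MatrixOrder

variable {n : ℕ} {M : Type*} [TopologicalSpace M] [ChartedSpace (Euc n) M]
  [IsManifold 𝓘(ℝ, Euc n) ∞ M] {g : Metric n M} {o : OrientationField n M} {p : M}

namespace NormalCoordinates

variable (x : NormalCoordinates g o p)

/-- The coordinate vector field `∂_i` on `V` (it is sent by the differential of the coordinate map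
to the `i`-th standard basis vector). -/
def partialField (i : Fin n) : VField n M :=
  VectorField.mpullback 𝓘(ℝ, Euc n) 𝓘(ℝ, Euc n) x.coord (constField (stdVec i))

/-- The matrix `G_m = (g_{ij}(m))`. -/
def G (m : M) : Matrix (Fin n) (Fin n) ℝ :=
  fun i j => g.inner m (x.partialField i m) (x.partialField j m)

/-- The matrix `B_m`, the positive square root of `G_m⁻¹`; its coefficients are
`b_i^j(m) = x.B m i j`. -/
def B (m : M) : Matrix (Fin n) (Fin n) ℝ := CFC.sqrt (x.G m)⁻¹

/-- The frame `e_i = ∑_j b_i^j ∂_j`. -/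
def e (i : Fin n) : VField n M := fun m => ∑ j, x.B m i j • x.partialField j m

/-- `Γ̃^k_{ij} = g(∇_{e_i} e_j, e_k)` for the Levi-Civita connection `∇` of `g`. -/
def Γt (i j k : Fin n) (m : M) : ℝ := koszul g (x.e i) (x.e j) (x.e k) m

/-- The partial derivative `∂_r f`. -/
def partialDeriv (r : Fin n) (f : M → ℝ) (m : M) : ℝ :=
  mvfderiv 𝓘(ℝ, Euc n) f m (x.partialField r m)

/-- `W = ¼ ∑ b_i^r (∂_r b_j^l) (b⁻¹)^k_l e_i · e_j · e_k`, a section of `Cl TV`; the sum is over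
all `r`, `l` and all pairwise distinct `i`, `j`, `k`. -/
def W (m : M) : ClTan g m :=
  (1 / 4 : ℝ) • ∑ i, ∑ j, ∑ k, if i ≠ j ∧ j ≠ k ∧ i ≠ k then
    (∑ r, ∑ l, x.B m i r * x.partialDeriv r (fun m' => x.B m' j l) m * (x.B m)⁻¹ l k) •
      (CliffordAlgebra.ι (tanForm g m) (x.e i m) * CliffordAlgebra.ι (tanForm g m) (x.e j m)
        * CliffordAlgebra.ι (tanForm g m) (x.e k m))
  else 0

/-- `V = ¼ ∑_{i,k} (Γ̃^i_{ik} - Γ̃^k_{ii}) e_k`, a vector field on `V`. -/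
def V : VField n M := fun m =>
  (1 / 4 : ℝ) • ∑ i, ∑ k, (x.Γt i k i m - x.Γt i i k m) • x.e k m

end NormalCoordinates

/-- A lift `η̄ : Spin(U, g_eucl) → Spin(V, g)` to the spin structures of the map
`η : SO(U, g_eucl) → SO(V, g)` given by the action of `B` on frames. It is described by its
values on the fibres: over the point of `U` with coordinates `x(m)` it takes values in the fibre
over `m ∈ V`. -/
structure BGLift (s : SpinStructure g o) (x : NormalCoordinates g o p) where
  toFun : ∀ m ∈ x.coord.source, (flatSpin n).P (x.coord m) → s.P m
  equivariant : ∀ m hm q (h : Spin n),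
    toFun m hm ((flatSpin n).act q h) = s.act (toFun m hm q) h
  /-- `σ ∘ η̄ = η ∘ σ_eucl`, where `B_m (a¹, …, aⁿ) = ∑_{i,j} b_i^j(m) aⁱ ∂_j(m)`. -/
  covers : ∀ m hm q (v : Euc n), (s.σ (toFun m hm q)).toLin v =
    ∑ i, ∑ j, (x.B m i j * (show Euc n from ((flatSpin n).σ q).toLin v) i) • x.partialField j m
  /-- `η̄` is smooth: it maps the constant section `1` of `Spin(U, g_eucl) = U × Spin(n)` to a smooth
  local section of `Spin(M, g)`. -/
  smooth : ∀ (y : M) (h : M → Spin n),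
    (∀ m (hm : m ∈ x.coord.source), m ∈ s.dom y →
      toFun m hm ((flatSpin n).sec (x.coord m) (x.coord m)) = s.act (s.sec y m) (h m)) →
    SmoothClOn n (fun m => (h m : Cl n)) (x.coord.source ∩ s.dom y)

variable {S : Type*} [NormedAddCommGroup S] [NormedSpace ℂ S]
  {s : SpinStructure g o} {x : NormalCoordinates g o p}

/-- The map `Σ_{x(m)}U → Σ_mV`, `[q, φ] ↦ [η̄(q), φ]`. -/
def BGLift.map (η : BGLift s x) (ρ : SpinorModule n S) (m : M) (hm : m ∈ x.coord.source) :
    Spinor (flatSpin n) ρ (x.coord m) → Spinor s ρ m :=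
  Quotient.lift (fun a => Spinor.mk s ρ (η.toFun m hm a.1) a.2) (by
    rintro a b ⟨h, h1, h2⟩
    refine Quotient.sound ⟨h, ?_, h2⟩
    change η.toFun m hm b.1 = _
    rw [h1, η.equivariant])

open Classical in
/-- The spinor field `ψ̄` on `V` corresponding to a spinor field `ψ` on `U` (set to `0` outside
of `V`). -/
def BGLift.bar (η : BGLift s x) (ρ : SpinorModule n S) (ψ : SpinorField (flatSpin n) ρ) :
    SpinorField s ρ :=
  fun m => if hm : m ∈ x.coord.source then η.map ρ m hm (ψ (x.coord m)) else 0

end BG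

end SpinGeometry

end

noncomputable section

/-! ### Contractions and the Euler operator on the exterior algebra. -/

section Contraction

open CliffordAlgebra

/-! Let `q` be the image under the lift of the constant section `1`. The orthonormal frame under `q`
is `e`, and `η.bar ρ ψ` has in `q` the same component `φ` (read through the chart) as `ψ` has in the
flat trivialization. In `q` the Dirac operator is therefore `∑ e_i · (∂_{e_i} φ + ¼ ∑ Γ̃^k_{ij} e_j
· e_k · φ)`. Since `∂_{e_i} = ∑ b_i^j ∂_j`, writing `b = δ + (b - δ)` in the derivative part gives
the transplanted flat Dirac operator and the last sum.

The rest is the cubic expression `¼ ∑ Γ̃^k_{ij} e_i e_j e_k`, split in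
`sum_smul_gen_mul_gen_mul_gen`. Terms with `i = j` or `i = k` collapse to vectors and give `V`;
those with `j = k` vanish by metric compatibility. For distinct indices the product is antisymmetric
in `i, j`, so only `Γ̃^k_{ij} - Γ̃^k_{ji} = g([e_i, e_j], e_k)` matters. As coordinate fields
commute, this is the antisymmetrization of `∑ b_i^r (∂_r b_j^l) (b⁻¹)_l^k` (`Γt_sub_swap`), which
gives `W`. The second form of `V` is the antisymmetry of `Γ̃` in its last two indices.

The longer part of the work is that `dirac` is defined through the preferred section at each point,
not through `q`, so its independence of the section has to be proved
(`IsDiffSection.nablaComponent_sec`, `IsDiffSection.dirac_eq`). If the sections differ by a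
`Spin(n)`-valued `h`, the derivative of `h` must be matched with the inhomogeneous term in the
change of connection coefficients, that is, `h' h⁻¹` must be the bivector with coefficients `a⁻¹
a'`, where `a` is the matrix of `Ad h` (`HasDirDeriv.spin`). This rests on an algebraic fact,
`eq_bivec_of_commutator`: commutators with vectors determine an even element that `star` negates,
because even elements commuting with all vectors are scalars. The latter is proved by turning
commutators into contractions and passing to the exterior algebra, where the Euler operator detects
the degree. -/

lemma CliffordAlgebra.ι_mul_sub_involute_mul_ι {R M : Type*} [CommRing R] [AddCommGroup M]
    [Module R M] {Q : QuadraticForm R M} (v : M) (x : CliffordAlgebra Q) :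
    ι Q v * x - involute x * ι Q v = contractLeft (Q.polarBilin v) x := by
  -- Both sides are antiderivations in `x` vanishing on scalars, so it suffices that they agree on
  -- vectors, where `v x + x v` is the polar form.
  induction x using CliffordAlgebra.left_induction with
  | algebraMap r => simp [Algebra.commutes]
  | add x y hx hy => rw [map_add, map_add, ← hx, ← hy, mul_add, add_mul]; abel
  | ι_mul x w hx =>
    rw [contractLeft_ι_mul, ← hx, map_mul, involute_ι, QuadraticMap.polarBilin_apply_apply,
      Algebra.smul_def, ← CliffordAlgebra.ι_mul_ι_add_swap]
    noncomm_ring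

namespace ExteriorAlgebra

variable {V ι' : Type*} [AddCommGroup V] [Module ℝ V] [Fintype ι']

/-- The Euler operator acts on the `k`-th exterior power as multiplication by `k`. -/
lemma sum_ι_mul_contractLeft (b : Module.Basis ι' ℝ V) (k : ℕ) (x : ExteriorAlgebra ℝ V)
    (hx : x ∈ ⋀[ℝ]^k V) :
    ∑ i, ExteriorAlgebra.ι ℝ (b i) * contractLeft (Q := (0 : QuadraticForm ℝ V)) (b.coord i) x
      = (k : ℝ) • x := by
  induction hx using Submodule.pow_induction_on_left' with
  | algebraMap r =>
    simp only [Nat.cast_zero, zero_smul]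
    exact Finset.sum_eq_zero fun i _ => by
      rw [contractLeft_algebraMap, mul_zero]
  | add x y k _ _ hx hy => simp only [map_add, mul_add, Finset.sum_add_distrib, hx, hy, smul_add]
  | mem_mul m hm k x _ hx =>
    obtain ⟨v, rfl⟩ := hm
    -- Leibniz rule and one anticommutation. Summed over `i`, the first terms rebuild `v`, which
    -- accounts for the extra degree; the second are `v` times the induction hypothesis.
    have h1 : ∀ i, ExteriorAlgebra.ι ℝ (b i) * contractLeft (Q := (0 : QuadraticForm ℝ V))
          (b.coord i) (ExteriorAlgebra.ι ℝ v * x)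
        = ExteriorAlgebra.ι ℝ (b.repr v i • b i) * x + ExteriorAlgebra.ι ℝ v *
          (ExteriorAlgebra.ι ℝ (b i) * contractLeft (Q := (0 : QuadraticForm ℝ V))
            (b.coord i) x) := by
      intro i
      have h2 : ExteriorAlgebra.ι ℝ (b i) * ExteriorAlgebra.ι ℝ v
          = - (ExteriorAlgebra.ι ℝ v * ExteriorAlgebra.ι ℝ (b i)) :=
        eq_neg_of_add_eq_zero_left (ExteriorAlgebra.ι_add_mul_swap _ _)
      rw [show contractLeft (Q := (0 : QuadraticForm ℝ V)) (b.coord i)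
          (ExteriorAlgebra.ι ℝ v * x) = _ from contractLeft_ι_mul _ v x, mul_sub, ← mul_assoc,
          show CliffordAlgebra.ι (0 : QuadraticForm ℝ V) v = ExteriorAlgebra.ι ℝ v from rfl,
          h2, map_smul]
      simp [mul_assoc]
    simp_rw [h1]
    rw [Finset.sum_add_distrib, ← Finset.mul_sum, hx, ← Finset.sum_mul, ← map_sum, b.sum_repr]
    rw [mul_smul_comm, Nat.cast_succ, add_smul, one_smul, add_comm]

/-- If all contractions vanish, the Euler operator kills `x`; as it multiplies the degree `k`
component by `k`, only degree `0` survives. -/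
lemma mem_range_algebraMap_of_contractLeft_eq_zero (b : Module.Basis ι' ℝ V)
    (x : ExteriorAlgebra ℝ V)
    (hx : ∀ d, contractLeft (Q := (0 : QuadraticForm ℝ V)) d x = 0) :
    ∃ r : ℝ, x = algebraMap ℝ _ r := by
  classical
  set N : ExteriorAlgebra ℝ V →ₗ[ℝ] ExteriorAlgebra ℝ V :=
    ∑ i, LinearMap.mulLeft ℝ (ExteriorAlgebra.ι ℝ (b i)) ∘ₗ
      contractLeft (Q := (0 : QuadraticForm ℝ V)) (b.coord i) with hN
  have hNk : ∀ (k : ℕ) (y : ExteriorAlgebra ℝ V), y ∈ ⋀[ℝ]^k V → N y = (k : ℝ) • y := by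
    intro k y hy
    rw [← sum_ι_mul_contractLeft b k y hy, hN, LinearMap.sum_apply]
    rfl
  have hNx : N x = 0 := by
    rw [hN, LinearMap.sum_apply]
    exact Finset.sum_eq_zero fun i _ => by simp [hx]
  have hk : ∀ k : ℕ, k ≠ 0 →
      (DirectSum.decompose (fun n ↦ ⋀[ℝ]^n V) x k : ExteriorAlgebra ℝ V) = 0 := by
    intro k hk
    -- The Euler operator preserves degrees, so it commutes with taking the degree `k` component.
    have h1 : (k : ℝ) • (DirectSum.decompose (fun n ↦ ⋀[ℝ]^n V) x k : ExteriorAlgebra ℝ V)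
        = DirectSum.decompose (fun n ↦ ⋀[ℝ]^n V) (N x) k := by
      conv_rhs => rw [← DirectSum.sum_support_decompose (fun n ↦ ⋀[ℝ]^n V) x, map_sum]
      rw [DirectSum.decompose_sum, DFinsupp.finsetSum_apply, AddSubmonoidClass.coe_finsetSum]
      have : ∀ i ∈ (DirectSum.decompose (fun n ↦ ⋀[ℝ]^n V) x).support,
          (DirectSum.decompose (fun n ↦ ⋀[ℝ]^n V)
            (N (DirectSum.decompose (fun n ↦ ⋀[ℝ]^n V) x i)) k : ExteriorAlgebra ℝ V)
          = if i = k then (k : ℝ) • (DirectSum.decompose (fun n ↦ ⋀[ℝ]^n V) x k :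
              ExteriorAlgebra ℝ V) else 0 := by
        intro i _
        rw [hNk i _ (SetLike.coe_mem _)]
        have hmem : (i : ℝ) • (DirectSum.decompose (fun n ↦ ⋀[ℝ]^n V) x i :
            ExteriorAlgebra ℝ V) ∈ ⋀[ℝ]^i V := Submodule.smul_mem _ _ (SetLike.coe_mem _)
        split_ifs with h
        · subst h
          exact DirectSum.decompose_of_mem_same (fun n ↦ ⋀[ℝ]^n V) hmem
        · exact DirectSum.decompose_of_mem_ne (fun n ↦ ⋀[ℝ]^n V) hmem h
      rw [Finset.sum_congr rfl this, Finset.sum_ite_eq']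
      split_ifs with h
      · rfl
      · rw [DFinsupp.notMem_support_iff.mp h]; simp
    rw [hNx] at h1
    simpa [hk] using h1
  have h0 : x = (DirectSum.decompose (fun n ↦ ⋀[ℝ]^n V) x 0 : ExteriorAlgebra ℝ V) := by
    conv_lhs => rw [← DirectSum.sum_support_decompose (fun n ↦ ⋀[ℝ]^n V) x]
    refine Finset.sum_eq_single 0 (fun k _ h => hk k h) fun h => ?_
    rw [DFinsupp.notMem_support_iff.mp h]; simp
  have h1 : x ∈ ⋀[ℝ]^0 V := by rw [h0]; exact SetLike.coe_mem _
  obtain ⟨r, hr⟩ := Submodule.mem_one.mp (show x ∈ (1 : Submodule ℝ (ExteriorAlgebra ℝ V)) from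
    pow_zero (LinearMap.range (ExteriorAlgebra.ι ℝ : V →ₗ[ℝ] ExteriorAlgebra ℝ V)) ▸ h1)
  exact ⟨r, hr.symm⟩

end ExteriorAlgebra

end Contraction

/-! ### Bivectors and cubic expressions in the Clifford algebra. -/

namespace SpinGeometry

instance finite_cl (n : ℕ) : Module.Finite ℝ (Cl n) := by
  have : Invertible (2 : ℝ) := invertibleOfNonzero two_ne_zero
  have : Module.Finite ℝ (ExteriorAlgebra ℝ (Euc n)) :=
    Module.Finite.of_basis (EuclideanSpace.basisFun (Fin n) ℝ).toBasis.ExteriorAlgebra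
  exact Module.Finite.equiv (CliffordAlgebra.equivExterior (negForm n)).symm

variable {n : ℕ}

lemma polar_negForm (v w : Euc n) : QuadraticMap.polar (negForm n) v w = -(2 * inner ℝ v w) := by
  simp only [QuadraticMap.polar, negForm_apply, real_inner_add_add_self]
  ring

/-- An even element of the Clifford algebra commuting with all vectors is a scalar. -/
lemma eq_algebraMap_of_even_of_commute (a : Cl n)
    (ha : a ∈ CliffordAlgebra.evenOdd (negForm n) 0)
    (hc : ∀ v, vec v * a = a * vec v) : ∃ r : ℝ, a = algebraMap ℝ _ r := by
  have : Invertible (2 : ℝ) := invertibleOfNonzero two_ne_zero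
  have h1 : ∀ d, CliffordAlgebra.contractLeft d a = 0 := by
    intro d
    -- The polar form is `-2⟨v, w⟩`, hence the factor `-1/2` on the Riesz representative.
    obtain ⟨v, rfl⟩ : ∃ v : Euc n, d = (negForm n).polarBilin v := by
      refine ⟨(-(1/2) : ℝ) • (InnerProductSpace.toDual ℝ (Euc n)).symm
        (LinearMap.toContinuousLinearMap d), ?_⟩
      ext w
      rw [QuadraticMap.polarBilin_apply_apply, polar_negForm, inner_smul_left]
      simp
    -- For even `a` the involution is trivial, so contraction is an ordinary commutator.
    rw [← CliffordAlgebra.ι_mul_sub_involute_mul_ι, CliffordAlgebra.involute_eq_of_mem_even ha, hc,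
      sub_self]
  -- The linear isomorphism with the exterior algebra intertwines contractions and fixes scalars.
  obtain ⟨r, hr⟩ := ExteriorAlgebra.mem_range_algebraMap_of_contractLeft_eq_zero
    (EuclideanSpace.basisFun (Fin n) ℝ).toBasis (CliffordAlgebra.equivExterior (negForm n) a)
    (by
      intro d
      refine (CliffordAlgebra.changeForm_contractLeft
        CliffordAlgebra.changeForm.associated_neg_proof d a).symm.trans ?_
      rw [h1, map_zero])
  refine ⟨r, (CliffordAlgebra.equivExterior (negForm n)).injective (hr.trans ?_)⟩
  exact (CliffordAlgebra.changeForm_algebraMap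
    CliffordAlgebra.changeForm.associated_neg_proof r).symm

/-- The standard basis vectors in the Clifford algebra. -/
abbrev gen (i : Fin n) : Cl n := vec (stdVec i)

lemma inner_stdVec (i j : Fin n) :
    inner ℝ (stdVec i) (stdVec j) = if i = j then (1 : ℝ) else 0 := by
  simp [stdVec, EuclideanSpace.inner_single_left]

lemma sum_smul_stdVec (v : Euc n) : ∑ i, v i • stdVec i = v := by
  ext j
  simp [stdVec, Pi.single_apply]

lemma gen_mul_self (i : Fin n) : gen i * gen i = -1 := by
  rw [CliffordAlgebra.ι_sq_scalar, negForm_apply, inner_stdVec, if_pos rfl, map_neg, map_one]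

lemma gen_mul_gen_of_ne {i j : Fin n} (h : i ≠ j) : gen j * gen i = -(gen i * gen j) := by
  have := CliffordAlgebra.ι_mul_ι_add_swap (Q := negForm n) (stdVec i) (stdVec j)
  rw [polar_negForm, inner_stdVec, if_neg h, mul_zero, neg_zero, map_zero] at this
  exact eq_neg_of_add_eq_zero_right this

lemma gen_mul_gen (i j : Fin n) :
    gen j * gen i = -(gen i * gen j) - (if i = j then (2 : ℝ) else 0) • 1 := by
  split_ifs with h
  · subst h
    rw [gen_mul_self, two_smul]
    abel
  · rw [gen_mul_gen_of_ne h, zero_smul, sub_zero]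

/-- Splitting of `∑ G_{ijk} e_i e_j e_k` into its cubic and linear parts. -/
lemma sum_smul_gen_mul_gen_mul_gen (G T : Fin n → Fin n → Fin n → ℝ)
    (hG : ∀ i j k, G i j k = -G i k j)
    (hGT : ∀ i j k, G i j k - G j i k = T i j k - T j i k) :
    ∑ i, ∑ j, ∑ k, G i j k • (gen i * (gen j * gen k))
      = (∑ i, ∑ j, ∑ k, if i ≠ j ∧ j ≠ k ∧ i ≠ k then T i j k • (gen i * gen j * gen k) else 0)
        + ∑ i, ∑ k, (G i k i - G i i k) • gen k := by
  have hG0 : ∀ i j, G i j j = 0 := fun i j => by linarith [hG i j j]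
  -- Here `e_i e_i e_k = -e_k` and `e_i e_j e_i = e_j` for `i ≠ j`, while `hG0` removes the terms
  -- with `j = k`.
  have h1 : ∀ i j k, G i j k • (gen i * (gen j * gen k))
      = (if i ≠ j ∧ j ≠ k ∧ i ≠ k then G i j k • (gen i * gen j * gen k) else 0)
        + ((if i = k then G i j i • gen j else 0) - (if i = j then G i i k • gen k else 0)) := by
    intro i j k
    by_cases hij : i = j
    · subst hij
      by_cases hik : i = k
      · subst hik; simp [hG0]
      · rw [← mul_assoc, gen_mul_self]; simp [hik]
    · by_cases hik : i = k
      · subst hik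
        rw [gen_mul_gen_of_ne hij, mul_neg, ← mul_assoc, gen_mul_self]
        simp [hij]
      · by_cases hjk : j = k
        · subst hjk; simp [hG0, hij]
        · simp [hij, hik, hjk, mul_assoc]
  -- By `hGT` the coefficient `G - T` is symmetric in `i, j` and the product is antisymmetric, so
  -- exchanging the two sums shows that the total is its own negative.
  have h2 : ∑ i, ∑ j, ∑ k, (if i ≠ j ∧ j ≠ k ∧ i ≠ k then
      (G i j k - T i j k) • (gen i * gen j * gen k) else 0) = 0 := by
    have h3 := Finset.sum_comm (s := Finset.univ) (t := Finset.univ)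
      (f := fun i j : Fin n => ∑ k, (if i ≠ j ∧ j ≠ k ∧ i ≠ k then
        (G i j k - T i j k) • (gen i * gen j * gen k) else 0))
    have h4 : ∑ j, ∑ i, ∑ k, (if i ≠ j ∧ j ≠ k ∧ i ≠ k then
        (G i j k - T i j k) • (gen i * gen j * gen k) else 0)
        = -∑ j, ∑ i, ∑ k, (if j ≠ i ∧ i ≠ k ∧ j ≠ k then
        (G j i k - T j i k) • (gen j * gen i * gen k) else 0) := by
      simp_rw [← Finset.sum_neg_distrib]
      refine Finset.sum_congr rfl fun j _ => Finset.sum_congr rfl fun i _ =>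
        Finset.sum_congr rfl fun k _ => ?_
      by_cases hij : i = j
      · simp [hij]
      by_cases hjk : j = k
      · simp [hjk]
      by_cases hik : i = k
      · simp [hik]
      rw [if_pos ⟨hij, hjk, hik⟩, if_pos ⟨Ne.symm hij, hik, hjk⟩, gen_mul_gen_of_ne hij, neg_mul,
        smul_neg, neg_neg]
      congr 1
      linarith [hGT i j k]
    rw [h4] at h3
    have h6 := add_eq_zero_iff_eq_neg.mpr h3
    rw [← two_smul ℝ] at h6
    exact (smul_eq_zero.mp h6).resolve_left two_ne_zero
  have h5 : ∀ i j k, (if i ≠ j ∧ j ≠ k ∧ i ≠ k then G i j k • (gen i * gen j * gen k) else 0)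
      = (if i ≠ j ∧ j ≠ k ∧ i ≠ k then T i j k • (gen i * gen j * gen k) else 0)
        + (if i ≠ j ∧ j ≠ k ∧ i ≠ k then
          (G i j k - T i j k) • (gen i * gen j * gen k) else 0) := by
    intro i j k
    split_ifs
    · rw [← add_smul]; congr 1; ring
    · simp
  simp_rw [h1, h5, Finset.sum_add_distrib, h2, add_zero]
  congr 1
  refine Finset.sum_congr rfl fun i _ => ?_
  simp_rw [Finset.sum_sub_distrib, sub_smul, Finset.sum_sub_distrib]
  congr 1
  · simp
  · rw [Finset.sum_comm]
    simp

/-- The element `¼ ∑ A_{pl} e_p e_l` of the Clifford algebra. -/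
def bivec (A : Fin n → Fin n → ℝ) : Cl n := (1 / 4 : ℝ) • ∑ p, ∑ l, A p l • (gen p * gen l)

/-- Moving `e_q` through `e_p e_l` takes two anticommutations, each leaving a linear term with
coefficient `±2`. By antisymmetry of `A` the two contributions agree, and `(2 + 2) / 4 = 1` explains
the normalization of `bivec`. -/
lemma bivec_commutator (A : Fin n → Fin n → ℝ) (hA : ∀ p l, A p l = -A l p) (q : Fin n) :
    bivec A * gen q - gen q * bivec A = ∑ l, A q l • gen l := by
  have h1 : ∀ p l, gen p * gen l * gen q - gen q * (gen p * gen l)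
      = (if q = p then (2 : ℝ) else 0) • gen l - (if q = l then (2 : ℝ) else 0) • gen p := by
    intro p l
    rw [mul_assoc, gen_mul_gen q l, ← mul_assoc (gen q), mul_sub, mul_neg, ← mul_assoc (gen p),
      gen_mul_gen q p, sub_mul, neg_mul, mul_smul_comm, smul_mul_assoc, mul_one, one_mul]
    abel
  have h2 : bivec A * gen q - gen q * bivec A
      = (1 / 4 : ℝ) • ∑ p, ∑ l, A p l • (gen p * gen l * gen q - gen q * (gen p * gen l)) := by
    simp only [bivec, smul_mul_assoc, mul_smul_comm, Finset.sum_mul, Finset.mul_sum, smul_sub,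
      Finset.sum_sub_distrib]
  rw [h2]
  simp_rw [h1, smul_sub, Finset.sum_sub_distrib]
  have h3 : ∑ p, ∑ l, A p l • (if q = p then (2 : ℝ) else 0) • gen l
      = (2 : ℝ) • ∑ l, A q l • gen l := by
    rw [Finset.sum_comm, Finset.smul_sum]
    refine Finset.sum_congr rfl fun l _ => ?_
    simp [smul_smul, mul_comm]
  have h4 : ∑ p, ∑ l, A p l • (if q = l then (2 : ℝ) else 0) • gen p
      = -((2 : ℝ) • ∑ l, A q l • gen l) := by
    rw [Finset.smul_sum, ← Finset.sum_neg_distrib]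
    refine Finset.sum_congr rfl fun l _ => ?_
    simp [smul_smul, mul_comm, hA l q]
  rw [h3, h4, sub_neg_eq_add, ← add_smul, smul_smul]
  norm_num

lemma star_bivec (A : Fin n → Fin n → ℝ) (hA : ∀ p l, A p l = -A l p) :
    star (bivec A) = -bivec A := by
  have h : ∀ (r : ℝ) (x : Cl n), star (r • x) = r • star x := CliffordAlgebra.star_smul
  simp only [bivec, h, star_sum, star_mul, CliffordAlgebra.star_ι, neg_mul_neg]
  rw [Finset.sum_comm, ← smul_neg, ← Finset.sum_neg_distrib]
  congr 1
  refine Finset.sum_congr rfl fun p _ => ?_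
  rw [← Finset.sum_neg_distrib]
  refine Finset.sum_congr rfl fun l _ => ?_
  rw [hA, neg_smul]

lemma bivec_mem_even (A : Fin n → Fin n → ℝ) :
    bivec A ∈ CliffordAlgebra.evenOdd (negForm n) 0 := by
  refine Submodule.smul_mem _ _ (Submodule.sum_mem _ fun p _ => Submodule.sum_mem _ fun l _ =>
    Submodule.smul_mem _ _ ?_)
  exact CliffordAlgebra.ι_mul_ι_mem_evenOdd_zero _ _ _

/-- An even, star-antisymmetric element of the Clifford algebra is determined by its commutators
with vectors. -/
lemma eq_bivec_of_commutator (a : Cl n) (A : Fin n → Fin n → ℝ) (hA : ∀ p l, A p l = -A l p)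
    (ha : a ∈ CliffordAlgebra.evenOdd (negForm n) 0) (hstar : star a = -a)
    (hc : ∀ q, a * gen q - gen q * a = ∑ l, A q l • gen l) : a = bivec A := by
  have hcomm : ∀ v, vec v * (a - bivec A) = (a - bivec A) * vec v := by
    intro v
    have hq : ∀ q, gen q * (a - bivec A) = (a - bivec A) * gen q := by
      intro q
      have := (hc q).trans (bivec_commutator A hA q).symm
      rw [mul_sub, sub_mul]
      rw [sub_eq_sub_iff_add_eq_add] at this ⊢
      rw [add_comm, ← this, add_comm]
    rw [← sum_smul_stdVec v, map_sum, Finset.sum_mul, Finset.mul_sum]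
    refine Finset.sum_congr rfl fun q _ => ?_
    rw [map_smul, smul_mul_assoc, hq, mul_smul_comm]
  obtain ⟨r, hr⟩ := eq_algebraMap_of_even_of_commute _
    (Submodule.sub_mem _ ha (bivec_mem_even A)) hcomm
  -- The difference is a real scalar, which `star` fixes, yet it is negated here; so it is zero.
  have h1 : star (a - bivec A) = -(a - bivec A) := by
    rw [star_sub, hstar, star_bivec A hA]; abel
  rw [hr, CliffordAlgebra.star_algebraMap, ← map_neg] at h1
  have := cl_nontrivial n
  have h2 := (algebraMap ℝ (Cl n)).injective h1
  rw [self_eq_neg.mp h2, map_zero] at hr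
  exact sub_eq_zero.mp hr

/-! ### Directional derivatives tested by linear functionals. -/

section DirDeriv

variable {n : ℕ} {M : Type*} [TopologicalSpace M] [ChartedSpace (Euc n) M]
  {V W U : Type*} [AddCommGroup V] [Module ℝ V] [AddCommGroup W] [Module ℝ W]
  [AddCommGroup U] [Module ℝ U] {m : M} {X : Tan n m}

/-- Directional derivatives of functions with values in a finite-dimensional vector space (without
a topology), computed by testing with linear functionals. -/
def HasDirDeriv (m : M) (X : Tan n m) (f : M → V) (f' : V) : Prop :=
  ∀ l : V →ₗ[ℝ] ℝ, MDifferentiableAt 𝓘(ℝ, Euc n) 𝓘(ℝ, ℝ) (fun y => l (f y)) m ∧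
    mvfderiv 𝓘(ℝ, Euc n) (fun y => l (f y)) m X = l f'

namespace HasDirDeriv

lemma comp {f : M → V} {f' : V} (h : HasDirDeriv m X f f') (T : V →ₗ[ℝ] W) :
    HasDirDeriv m X (fun y => T (f y)) (T f') := fun l => h (l ∘ₗ T)

lemma const (c : V) : HasDirDeriv m X (fun _ => c) 0 := fun l =>
  ⟨mdifferentiableAt_const, by rw [mvfderiv_const]; simp⟩

lemma add {f g : M → V} {f' g' : V} (hf : HasDirDeriv m X f f') (hg : HasDirDeriv m X g g') :
    HasDirDeriv m X (fun y => f y + g y) (f' + g') := fun l => by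
  simp only [map_add]
  exact ⟨(hf l).1.add (hg l).1, by
    rw [mvfderiv_fun_add (hf l).1 (hg l).1, add_apply, (hf l).2, (hg l).2]⟩

lemma sum {ι : Type*} (s : Finset ι) {f : ι → M → V} {f' : ι → V}
    (hf : ∀ i ∈ s, HasDirDeriv m X (f i) (f' i)) :
    HasDirDeriv m X (fun y => ∑ i ∈ s, f i y) (∑ i ∈ s, f' i) := by
  classical
  induction s using Finset.induction_on with
  | empty => simpa using const (0 : V)
  | insert i s hi ih =>
    simp only [Finset.sum_insert hi]
    exact (hf i (by simp)).add (ih fun j hj => hf j (by simp [hj]))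

lemma congr {f g : M → V} {f' : V} (hf : HasDirDeriv m X f f') (h : g =ᶠ[𝓝 m] f) :
    HasDirDeriv m X g f' := fun l => by
  have hl : (fun y => l (g y)) =ᶠ[𝓝 m] fun y => l (f y) := h.fun_comp l
  refine ⟨(hf l).1.congr_of_eventuallyEq hl, ?_⟩
  rw [← (hf l).2]
  simp only [mvfderiv, ContinuousLinearMap.comp_apply, hl.mfderiv_eq]
  rfl

lemma unique {f : M → V} {f' f'' : V} (h : HasDirDeriv m X f f')
    (h' : HasDirDeriv m X f f'') : f' = f'' := by
  rw [← sub_eq_zero, ← Module.forall_dual_apply_eq_zero_iff ℝ]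
  intro l
  rw [map_sub, ← (h l).2, ← (h' l).2, sub_self]

lemma mul_real {f g : M → ℝ} {f' g' : ℝ} (hf : HasDirDeriv m X f f')
    (hg : HasDirDeriv m X g g') : HasDirDeriv m X (fun y => f y * g y) (f' * g m + f m * g') := by
  intro l
  have hl : ∀ x, l x = x * l 1 := fun x => by
    conv_lhs => rw [← mul_one x, ← smul_eq_mul, map_smul, smul_eq_mul]
  have hf := hf LinearMap.id
  have hg := hg (l 1 • LinearMap.id)
  simp only [LinearMap.id_apply, LinearMap.smul_apply, smul_eq_mul] at hf hg
  have h1 : (fun y => l (f y * g y)) = fun y => f y * (l 1 * g y) := by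
    ext y; rw [hl]; ring
  rw [h1]
  refine ⟨hf.1.mul hg.1, ?_⟩
  rw [mvfderiv_fun_mul hf.1 hg.1]
  simp only [add_apply, smul_apply, hf.2, hg.2, hl (f' * g m + f m * g'),
    smul_eq_mul]
  ring

/-- Finite bases reduce the product rule to that for real functions. The two uses are the Clifford
product and its action on spinors. -/
lemma bilin [Module.Finite ℝ V] [Module.Finite ℝ W] (B : V →ₗ[ℝ] W →ₗ[ℝ] U)
    {f : M → V} {f' : V} {g : M → W} {g' : W}
    (hf : HasDirDeriv m X f f') (hg : HasDirDeriv m X g g') :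
    HasDirDeriv m X (fun y => B (f y) (g y)) (B f' (g m) + B (f m) g') := by
  let b := Module.finBasis ℝ V
  let c := Module.finBasis ℝ W
  have hB : ∀ v w, B v w = ∑ i, ∑ j, (b.coord i v * c.coord j w) • B (b i) (c j) := by
    intro v w
    conv_lhs => rw [← b.sum_repr v, ← c.sum_repr w]
    simp only [map_sum, map_smul, LinearMap.sum_apply, LinearMap.smul_apply, Finset.smul_sum,
      smul_smul, Module.Basis.coord_apply]
    rw [Finset.sum_comm]
    simp_rw [mul_comm]
  rw [show (fun y => B (f y) (g y)) = _ from funext fun y => hB (f y) (g y), hB f', hB (f m)]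
  simp only [← Finset.sum_add_distrib, ← add_smul]
  refine sum _ fun i _ => sum _ fun j _ => ?_
  exact ((hf.comp (b.coord i)).mul_real (hg.comp (c.coord j))).comp
    (LinearMap.toSpanSingleton ℝ U (B (b i) (c j)))

end HasDirDeriv

lemma hasDirDeriv_real {f : M → ℝ} (hf : MDifferentiableAt 𝓘(ℝ, Euc n) 𝓘(ℝ, ℝ) f m) :
    HasDirDeriv m X f (mvfderiv 𝓘(ℝ, Euc n) f m X) := by
  intro l
  have hl : ∀ x, l x = x * l 1 := fun x => by
    conv_lhs => rw [← mul_one x, ← smul_eq_mul, map_smul, smul_eq_mul]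
  have hc : MDifferentiableAt 𝓘(ℝ, Euc n) 𝓘(ℝ, ℝ) (fun _ : M => l 1) m := mdifferentiableAt_const
  rw [show (fun y => l (f y)) = fun y => f y * l 1 from funext fun y => hl _]
  refine ⟨hf.mul hc, ?_⟩
  rw [mvfderiv_fun_mul hf hc, mvfderiv_const, hl (mvfderiv _ _ _ _)]
  simp [mul_comm]

lemma hasDirDeriv_real_iff {f : M → ℝ} {f' : ℝ} : HasDirDeriv m X f f' ↔
    MDifferentiableAt 𝓘(ℝ, Euc n) 𝓘(ℝ, ℝ) f m ∧ mvfderiv 𝓘(ℝ, Euc n) f m X = f' :=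
  ⟨fun h => h LinearMap.id, fun h => h.2 ▸ hasDirDeriv_real h.1⟩

section Normed

variable {F : Type*} [NormedAddCommGroup F] [NormedSpace ℝ F] [FiniteDimensional ℝ F]

lemma hasDirDeriv_of_mdifferentiableAt {f : M → F}
    (hf : MDifferentiableAt 𝓘(ℝ, Euc n) 𝓘(ℝ, F) f m) :
    HasDirDeriv m X f (mvfderiv 𝓘(ℝ, Euc n) f m X) := by
  intro l
  set L := LinearMap.toContinuousLinearMap l
  have hL : HasMFDerivAt 𝓘(ℝ, F) 𝓘(ℝ, ℝ) L (f m) L := L.hasMFDerivAt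
  have h := hL.comp m hf.hasMFDerivAt
  refine ⟨h.mdifferentiableAt, ?_⟩
  have h2 : mfderiv 𝓘(ℝ, Euc n) 𝓘(ℝ, ℝ) (fun y => l (f y)) m = _ := h.mfderiv
  simp only [mvfderiv, ContinuousLinearMap.comp_apply, h2]
  rfl

lemma mdifferentiableAt_of_dual {f : M → F}
    (hf : ∀ l : F →ₗ[ℝ] ℝ, MDifferentiableAt 𝓘(ℝ, Euc n) 𝓘(ℝ, ℝ) (fun y => l (f y)) m) :
    MDifferentiableAt 𝓘(ℝ, Euc n) 𝓘(ℝ, F) f m := by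
  let b := Module.finBasis ℝ F
  have : f = fun y => ∑ i, b.coord i (f y) • b i := funext fun y => (b.sum_repr _).symm
  rw [this]
  have h1 : ∀ i, MDifferentiableAt 𝓘(ℝ, Euc n) 𝓘(ℝ, F) (fun y => b.coord i (f y) • b i) m :=
    fun i => (hf (b.coord i)).smul mdifferentiableAt_const
  convert! MDifferentiableAt.sum (t := Finset.univ) fun i _ => h1 i
  simp

lemma hasDirDeriv_iff {f : M → F} {f' : F} : HasDirDeriv m X f f' ↔
    MDifferentiableAt 𝓘(ℝ, Euc n) 𝓘(ℝ, F) f m ∧ mvfderiv 𝓘(ℝ, Euc n) f m X = f' := by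
  constructor
  · intro h
    have h1 := mdifferentiableAt_of_dual fun l => (h l).1
    exact ⟨h1, (hasDirDeriv_of_mdifferentiableAt h1).unique h⟩
  · rintro ⟨h, rfl⟩
    exact hasDirDeriv_of_mdifferentiableAt h

end Normed

lemma exists_hasDirDeriv [Module.Finite ℝ V] {f : M → V}
    (hf : ∀ l : V →ₗ[ℝ] ℝ, MDifferentiableAt 𝓘(ℝ, Euc n) 𝓘(ℝ, ℝ) (fun y => l (f y)) m) :
    ∃ f', HasDirDeriv m X f f' := by
  let b := Module.finBasis ℝ V
  have h : f = fun y => ∑ i, LinearMap.toSpanSingleton ℝ V (b i) (b.coord i (f y)) :=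
    funext fun y => (b.sum_repr _).symm
  rw [h]
  exact ⟨_, HasDirDeriv.sum _ fun i _ => (hasDirDeriv_real (hf (b.coord i))).comp _⟩

/-! ### Derivatives of `Spin(n)`-valued functions. -/

/-- The matrix of `Ad h`. -/
def adMat (h : Spin n) (j l : Fin n) : ℝ := Ad h (stdVec j) l

lemma Ad_stdVec (h : Spin n) (j : Fin n) : Ad h (stdVec j) = ∑ l, adMat h j l • stdVec l :=
  (sum_smul_stdVec _).symm

lemma vec_Ad_stdVec (h : Spin n) (j : Fin n) :
    ∑ l, adMat h j l • gen l = (h : Cl n) * gen j * ((h⁻¹ : Spin n) : Cl n) := by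
  rw [← vec_Ad, Ad_stdVec, map_sum]
  simp_rw [map_smul]

lemma adMat_mul_transpose (h : Spin n) (j k : Fin n) :
    ∑ l, adMat h j l * adMat h k l = if j = k then 1 else 0 := by
  have h1 := inner_Ad h (stdVec j) (stdVec k)
  rw [inner_stdVec] at h1
  rw [← h1, PiLp.inner_apply]
  simp [adMat, mul_comm]

lemma adMat_transpose_mul (h : Spin n) (p q : Fin n) :
    ∑ j, adMat h j p * adMat h j q = if p = q then 1 else 0 := by
  have h1 : (Matrix.of (adMat h)) * (Matrix.of (adMat h)).transpose = 1 := by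
    ext j k
    simp [Matrix.mul_apply, adMat_mul_transpose, Matrix.one_apply]
  have h2 := congrArg (fun A : Matrix (Fin n) (Fin n) ℝ => A p q) (mul_eq_one_comm.mp h1)
  simpa [Matrix.mul_apply, Matrix.one_apply] using h2

/-- Lets derivatives of `vec (Ad h v)`, computed in the Clifford algebra, be read back in `ℝⁿ`. -/
lemma exists_vec_leftInverse : ∃ L : Cl n →ₗ[ℝ] Euc n, ∀ v, L (vec v) = v := by
  obtain ⟨L, hL⟩ := LinearMap.exists_leftInverse_of_injective (vec (n := n))
    (LinearMap.ker_eq_bot.mpr vec_injective)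
  exact ⟨L, fun v => congrArg (fun f => f v) hL⟩

/-- Derivative of a `Spin(n)`-valued function in terms of the derivative of its image in
`SO(n)`. -/
lemma HasDirDeriv.spin {h : M → Spin n} {h' : Cl n}
    (hh : HasDirDeriv m X (fun y => (h y : Cl n)) h') :
    ∃ a' : Fin n → Fin n → ℝ, (∀ j l, HasDirDeriv m X (fun y => adMat (h y) j l) (a' j l)) ∧
      h' = bivec (fun p l => ∑ j, adMat (h m) j p * a' j l) * (h m : Cl n) := by
  let st : Cl n →ₗ[ℝ] Cl n :=
    { toFun := star, map_add' := star_add, map_smul' := CliffordAlgebra.star_smul }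
  have hst : ∀ k : Spin n, st (k : Cl n) = ((k⁻¹ : Spin n) : Cl n) := fun k => rfl
  obtain ⟨L, hL⟩ := exists_vec_leftInverse (n := n)
  let μ := LinearMap.mul ℝ (Cl n)
  have hinv : HasDirDeriv m X (fun y => (((h y)⁻¹ : Spin n) : Cl n)) (star h') := hh.comp st
  have hconj : ∀ v, HasDirDeriv m X (fun y => vec (Ad (h y) v))
      (h' * vec v * (((h m)⁻¹ : Spin n) : Cl n) + (h m : Cl n) * vec v * star h') := by
    intro v
    simp only [vec_Ad]
    have := (hh.comp (μ.flip (vec v))).bilin μ hinv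
    exact this
  have hAd : ∀ v, HasDirDeriv m X (fun y => Ad (h y) v)
      (L (h' * vec v * (((h m)⁻¹ : Spin n) : Cl n) + (h m : Cl n) * vec v * star h')) := by
    intro v
    have := (hconj v).comp L
    simpa only [hL] using this
  -- By uniqueness of derivatives, the derivative of a function with values in the range of `vec`
  -- lies in that range.
  have hvecL : ∀ v, vec (L (h' * vec v * (((h m)⁻¹ : Spin n) : Cl n)
      + (h m : Cl n) * vec v * star h'))
      = h' * vec v * (((h m)⁻¹ : Spin n) : Cl n) + (h m : Cl n) * vec v * star h' :=
    fun v => ((hAd v).comp vec).unique (hconj v)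
  set d : Euc n → Euc n := fun v =>
    L (h' * vec v * (((h m)⁻¹ : Spin n) : Cl n) + (h m : Cl n) * vec v * star h') with hd
  have hunit : h' * (((h m)⁻¹ : Spin n) : Cl n) + (h m : Cl n) * star h' = 0 := by
    have h1 := hh.bilin μ hinv
    have h2 : (fun y => μ (h y : Cl n) (((h y)⁻¹ : Spin n) : Cl n)) = fun _ => 1 :=
      funext fun y => spin_mul_inv (h y)
    rw [h2] at h1
    exact h1.unique (HasDirDeriv.const 1)
  have ha : ∀ j l, HasDirDeriv m X (fun y => adMat (h y) j l) (d (stdVec j) l) := by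
    intro j l
    exact (hAd (stdVec j)).comp (EuclideanSpace.proj l : Euc n →L[ℝ] ℝ).toLinearMap
  refine ⟨fun j l => d (stdVec j) l, ha, ?_⟩
  -- The logarithmic derivative `θ = h' h⁻¹`. It remains to show that it is even, that `star`
  -- negates it, and that its commutators with vectors are given by the derivative of `Ad h`.
  set θ : Cl n := h' * (((h m)⁻¹ : Spin n) : Cl n) with hθ
  have hθm : θ * (h m : Cl n) = h' := by rw [hθ, mul_assoc, spin_inv_mul, mul_one]
  rw [← hθm]
  congr 1
  -- Modulo the even part the function is constantly zero, hence so is its derivative.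
  have heven : h' ∈ CliffordAlgebra.evenOdd (negForm n) 0 := by
    rw [← Submodule.Quotient.mk_eq_zero]
    refine (hh.comp (CliffordAlgebra.evenOdd (negForm n) 0).mkQ).unique ?_
    convert! HasDirDeriv.const (m := m) (X := X)
      (0 : Cl n ⧸ CliffordAlgebra.evenOdd (negForm n) 0) using 2 with y
    exact (Submodule.Quotient.mk_eq_zero _).mpr (spinGroup.mem_even (h y).2)
  have hstarh : star h' = -((((h m)⁻¹ : Spin n) : Cl n) * θ) := by
    have h1 := congrArg (fun x => (((h m)⁻¹ : Spin n) : Cl n) * x) hunit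
    simp only [mul_add, mul_zero, ← mul_assoc, spin_inv_mul, one_mul] at h1
    exact eq_neg_of_add_eq_zero_right h1
  refine eq_bivec_of_commutator θ _ ?_ ?_ ?_ ?_
  · intro p l
    -- Antisymmetry of the coefficients: differentiate the orthogonality relation of `adMat`.
    have h1 : HasDirDeriv m X (fun y => ∑ j, adMat (h y) j p * adMat (h y) j l)
        (∑ j, (d (stdVec j) p * adMat (h m) j l + adMat (h m) j p * d (stdVec j) l)) :=
      HasDirDeriv.sum _ fun j _ => (ha j p).mul_real (ha j l)
    simp only [adMat_transpose_mul] at h1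
    have h2 := h1.unique (HasDirDeriv.const _)
    rw [Finset.sum_add_distrib] at h2
    rw [eq_neg_iff_add_eq_zero, add_comm, ← h2]
    congr 1
    exact Finset.sum_congr rfl fun j _ => mul_comm _ _
  · have := SetLike.mul_mem_graded (A := CliffordAlgebra.evenOdd (negForm n)) heven
      (spinGroup.mem_even ((h m)⁻¹).2)
    exact this
  · rw [hθ, star_mul]
    have : star ((((h m)⁻¹ : Spin n) : Cl n)) = (h m : Cl n) := by
      rw [← hst, show st (h m : Cl n) = star (h m : Cl n) from rfl, star_star]
    rw [this]
    exact eq_neg_of_add_eq_zero_right hunit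
  · intro q
    -- The commutator is easiest on the rotated vectors `h e_j h⁻¹`, where it is the derivative of
    -- `Ad h e_j`; orthogonality expresses `e_q` through them.
    have hq : ∑ j, adMat (h m) j q • ((h m : Cl n) * gen j * (((h m)⁻¹ : Spin n) : Cl n))
        = gen q := by
      simp_rw [← vec_Ad_stdVec, Finset.smul_sum, smul_smul]
      rw [Finset.sum_comm]
      simp_rw [← Finset.sum_smul, adMat_transpose_mul]
      simp
    have hj : ∀ j, θ * ((h m : Cl n) * gen j * (((h m)⁻¹ : Spin n) : Cl n))
        - ((h m : Cl n) * gen j * (((h m)⁻¹ : Spin n) : Cl n)) * θ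
        = ∑ l, d (stdVec j) l • gen l := by
      intro j
      have h1 : ∑ l, d (stdVec j) l • gen l = vec (d (stdVec j)) := by
        conv_rhs => rw [← sum_smul_stdVec (d (stdVec j)), map_sum]
        simp_rw [map_smul]
      rw [h1, hd]
      refine Eq.trans ?_ (hvecL (stdVec j)).symm
      rw [hstarh, mul_neg, ← sub_eq_add_neg]
      congr 1
      · rw [← mul_assoc, ← mul_assoc, hθm]
      · rw [mul_assoc, mul_assoc]
    rw [← hq, Finset.mul_sum, Finset.sum_mul, ← Finset.sum_sub_distrib]
    simp_rw [mul_smul_comm, smul_mul_assoc, ← smul_sub, hj, Finset.sum_smul, Finset.smul_sum,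
      smul_smul]
    rw [Finset.sum_comm]

end DirDeriv

/-! ### Calculus of the Koszul expression. -/

section Koszul

variable {n : ℕ} {M : Type*} [TopologicalSpace M] [ChartedSpace (Euc n) M]
  [IsManifold 𝓘(ℝ, Euc n) ∞ M] {m : M}

lemma isManifold_two : IsManifold 𝓘(ℝ, Euc n) 2 M := IsManifold.of_le (n := ∞) (by norm_cast)

/-- Differentiability of a vector field at a point. -/
def DiffField (X : VField n M) (m : M) : Prop :=
  MDifferentiableAt 𝓘(ℝ, Euc n) 𝓘(ℝ, Euc n).tangent
    (fun y => (⟨y, X y⟩ : TangentBundle 𝓘(ℝ, Euc n) M)) m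

/-- Differentiability of a real function at a point. -/
abbrev DiffFun (f : M → ℝ) (m : M) : Prop := MDifferentiableAt 𝓘(ℝ, Euc n) 𝓘(ℝ, ℝ) f m

lemma DiffField.smul {X : VField n M} {f : M → ℝ} (hX : DiffField X m) (hf : DiffFun (n := n) f m) :
    DiffField (fun y => f y • X y) m := MDifferentiableAt.smul_section hf hX

lemma DiffField.add {X Y : VField n M} (hX : DiffField X m) (hY : DiffField Y m) :
    DiffField (fun y => X y + Y y) m := mdifferentiableAt_add_section hX hY

lemma DiffField.sum {ι : Type*} (s : Finset ι) {X : ι → VField n M}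
    (hX : ∀ i ∈ s, DiffField (X i) m) :
    DiffField (fun y => ∑ i ∈ s, X i y) m := MDifferentiableAt.sum_section hX

lemma DiffField.congr {X Y : VField n M} (hX : DiffField X m) (h : ∀ᶠ y in 𝓝 m, Y y = X y) :
    DiffField Y m := by
  refine MDifferentiableAt.congr_of_eventuallyEq hX ?_
  filter_upwards [h] with y hy
  rw [hy]

lemma SmoothVFieldOn.diffField {X : VField n M} {s : Set M} (hX : SmoothVFieldOn X s)
    (hs : s ∈ 𝓝 m) : DiffField X m :=
  (hX.contMDiffAt hs).mdifferentiableAt (by simp)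

variable {g : Metric n M} {X Y Z X' Y' Z' : VField n M} {f : M → ℝ}

lemma DiffField.inner (g : Metric n M) (hX : DiffField X m) (hY : DiffField Y m) :
    DiffFun (n := n) (fun y => g.inner y (X y) (Y y)) m := by
  have h1 := (g.contMDiff m).mdifferentiableAt (by simp)
  have h2 := MDifferentiableAt.clm_bundle_apply₂ (F₁ := Euc n) (F₂ := Euc n) (F₃ := ℝ)
    (E₁ := fun x : M => Tan n x) (E₂ := fun x : M => Tan n x) (E₃ := Bundle.Trivial M ℝ)
    (b := fun y : M => y) (ψ := g.inner) h1 hX hY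
  exact (mdifferentiableAt_section _ _).mp h2

lemma koszul_congr (hX : ∀ᶠ y in 𝓝 m, X y = X' y) (hY : ∀ᶠ y in 𝓝 m, Y y = Y' y)
    (hZ : ∀ᶠ y in 𝓝 m, Z y = Z' y) : koszul g X Y Z m = koszul g X' Y' Z' m := by
  have h : ∀ {A A' B B' : VField n M}, (∀ᶠ y in 𝓝 m, A y = A' y) → (∀ᶠ y in 𝓝 m, B y = B' y) →
      mvfderiv 𝓘(ℝ, Euc n) (fun y => g.inner y (A y) (B y)) m
        = mvfderiv 𝓘(ℝ, Euc n) (fun y => g.inner y (A' y) (B' y)) m := by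
    intro A A' B B' hA hB
    have : (fun y => g.inner y (A y) (B y)) =ᶠ[𝓝 m] (fun y => g.inner y (A' y) (B' y)) := by
      filter_upwards [hA, hB] with y h1 h2
      rw [h1, h2]
    ext v
    simp only [mvfderiv, ContinuousLinearMap.comp_apply, this.mfderiv_eq]
    rfl
  simp only [koszul]
  rw [h hY hZ, h hZ hX, h hX hY, Filter.EventuallyEq.mlieBracket_vectorField_eq hX hY,
    Filter.EventuallyEq.mlieBracket_vectorField_eq hY hZ,
    Filter.EventuallyEq.mlieBracket_vectorField_eq hZ hX, hX.self_of_nhds, hY.self_of_nhds,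
    hZ.self_of_nhds]

/-- Compatibility with the metric. -/
lemma koszul_add_koszul_swap (g : Metric n M) (X Y Z : VField n M) (m : M) :
    koszul g X Y Z m + koszul g X Z Y m
      = mvfderiv 𝓘(ℝ, Euc n) (fun y => g.inner y (Y y) (Z y)) m (X m) := by
  simp only [koszul]
  rw [VectorField.mlieBracket_swap_apply (V := X) (W := Z),
    VectorField.mlieBracket_swap_apply (V := Z) (W := Y),
    VectorField.mlieBracket_swap_apply (V := Y) (W := X),
    show (fun y => g.inner y (Y y) (X y)) = fun y => g.inner y (X y) (Y y) from
      funext fun y => g.symm _ _ _,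
    show (fun y => g.inner y (X y) (Z y)) = fun y => g.inner y (Z y) (X y) from
      funext fun y => g.symm _ _ _,
    show (fun y => g.inner y (Z y) (Y y)) = fun y => g.inner y (Y y) (Z y) from
      funext fun y => g.symm _ _ _]
  simp only [map_neg, neg_apply]
  ring

/-- Torsion-freeness. -/
lemma koszul_sub_koszul_swap (g : Metric n M) (X Y Z : VField n M) (m : M) :
    koszul g X Y Z m - koszul g Y X Z m
      = g.inner m (VectorField.mlieBracket 𝓘(ℝ, Euc n) X Y m) (Z m) := by
  simp only [koszul]
  rw [VectorField.mlieBracket_swap_apply (V := X) (W := Z),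
    VectorField.mlieBracket_swap_apply (V := Z) (W := Y),
    VectorField.mlieBracket_swap_apply (V := Y) (W := X),
    show (fun y => g.inner y (Y y) (X y)) = fun y => g.inner y (X y) (Y y) from
      funext fun y => g.symm _ _ _,
    show (fun y => g.inner y (X y) (Z y)) = fun y => g.inner y (Z y) (X y) from
      funext fun y => g.symm _ _ _,
    show (fun y => g.inner y (Z y) (Y y)) = fun y => g.inner y (Y y) (Z y) from
      funext fun y => g.symm _ _ _]
  simp only [map_neg, neg_apply]
  ring

/-- The derivatives of `f` along `X` and `Y` produced by the metric terms cancel those produced by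
the brackets with `f Z`. -/
lemma koszul_smul_right (hX : DiffField X m) (hY : DiffField Y m) (hZ : DiffField Z m)
    (hf : DiffFun (n := n) f m) :
    koszul g X Y (fun y => f y • Z y) m = f m * koszul g X Y Z m := by
  have := isManifold_two (n := n) (M := M)
  have h1 : mvfderiv 𝓘(ℝ, Euc n) (fun y => g.inner y (Y y) (f y • Z y)) m
      = f m • mvfderiv 𝓘(ℝ, Euc n) (fun y => g.inner y (Y y) (Z y)) m
        + g.inner m (Y m) (Z m) • mvfderiv 𝓘(ℝ, Euc n) f m := by
    rw [← mvfderiv_fun_mul hf (hY.inner g hZ)]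
    simp
  have h2 : mvfderiv 𝓘(ℝ, Euc n) (fun y => g.inner y (f y • Z y) (X y)) m
      = f m • mvfderiv 𝓘(ℝ, Euc n) (fun y => g.inner y (Z y) (X y)) m
        + g.inner m (Z m) (X m) • mvfderiv 𝓘(ℝ, Euc n) f m := by
    rw [← mvfderiv_fun_mul hf (hZ.inner g hX)]
    simp
  have h3 := VectorField.mlieBracket_smul_right (V := Y) hf hZ
  have h4 := VectorField.mlieBracket_smul_left (W := X) hf hZ
  have h5 : (fun y => f y • Z y) = f • Z := rfl
  simp only [koszul]
  rw [h1, h2, h5, h3, h4]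
  simp only [map_add, map_smul, map_neg, neg_smul, add_apply, smul_apply, neg_apply, smul_eq_mul,
    g.symm m (Z m) (Y m)]
  ring

lemma koszul_add_right (hX : DiffField X m) (hY : DiffField Y m) (hZ : DiffField Z m)
    (hZ' : DiffField Z' m) :
    koszul g X Y (fun y => Z y + Z' y) m = koszul g X Y Z m + koszul g X Y Z' m := by
  have := isManifold_two (n := n) (M := M)
  have h1 : mvfderiv 𝓘(ℝ, Euc n) (fun y => g.inner y (Y y) (Z y + Z' y)) m
      = mvfderiv 𝓘(ℝ, Euc n) (fun y => g.inner y (Y y) (Z y)) m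
        + mvfderiv 𝓘(ℝ, Euc n) (fun y => g.inner y (Y y) (Z' y)) m := by
    rw [← mvfderiv_fun_add (hY.inner g hZ) (hY.inner g hZ')]
    simp
  have h2 : mvfderiv 𝓘(ℝ, Euc n) (fun y => g.inner y (Z y + Z' y) (X y)) m
      = mvfderiv 𝓘(ℝ, Euc n) (fun y => g.inner y (Z y) (X y)) m
        + mvfderiv 𝓘(ℝ, Euc n) (fun y => g.inner y (Z' y) (X y)) m := by
    rw [← mvfderiv_fun_add (hZ.inner g hX) (hZ'.inner g hX)]
    simp
  have h3 := VectorField.mlieBracket_add_right (V := Y) hZ hZ'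
  have h4 := VectorField.mlieBracket_add_left (W := X) hZ hZ'
  have h5 : (fun y => Z y + Z' y) = Z + Z' := rfl
  simp only [koszul]
  rw [h1, h2, h5, h3, h4]
  simp only [map_add, add_apply]
  ring

variable {ι : Type*} {a : ι → M → ℝ} {F : ι → VField n M}

lemma koszul_sum_right (s : Finset ι) (hX : DiffField X m) (hY : DiffField Y m)
    (hF : ∀ i, DiffField (F i) m) (ha : ∀ i, DiffFun (n := n) (a i) m) :
    koszul g X Y (fun y => ∑ i ∈ s, a i y • F i y) m = ∑ i ∈ s, a i m * koszul g X Y (F i) m := by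
  classical
  induction s using Finset.induction_on with
  | empty =>
    have := koszul_smul_right (g := g) hX hY hX (f := fun _ => 0) mdifferentiableAt_const
    simpa using this
  | insert i s hi ih =>
    simp only [Finset.sum_insert hi]
    rw [koszul_add_right hX hY ((hF i).smul (ha i))
      (DiffField.sum s fun j _ => (hF j).smul (ha j)), ih, koszul_smul_right hX hY (hF i) (ha i)]

lemma mvfderiv_inner_sum (s : Finset ι) (hZ : DiffField Z m) (hF : ∀ i, DiffField (F i) m)
    (ha : ∀ i, DiffFun (n := n) (a i) m) (v : Tan n m) :
    mvfderiv 𝓘(ℝ, Euc n) (fun y => g.inner y (∑ i ∈ s, a i y • F i y) (Z y)) m v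
      = ∑ i ∈ s, (mvfderiv 𝓘(ℝ, Euc n) (a i) m v * g.inner m (F i m) (Z m)
        + a i m * mvfderiv 𝓘(ℝ, Euc n) (fun y => g.inner y (F i y) (Z y)) m v) := by
  have h := HasDirDeriv.sum (m := m) (X := v) s fun i _ =>
    (hasDirDeriv_real (ha i)).mul_real (hasDirDeriv_real ((hF i).inner g hZ))
  rw [← (hasDirDeriv_real_iff.mp h).2]
  simp

/-- The Leibniz rule in the middle slot follows from metric compatibility and linearity in the last
slot. -/
lemma koszul_sum_middle (s : Finset ι) (hX : DiffField X m) (hZ : DiffField Z m)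
    (hF : ∀ i, DiffField (F i) m) (ha : ∀ i, DiffFun (n := n) (a i) m) :
    koszul g X (fun y => ∑ i ∈ s, a i y • F i y) Z m
      = ∑ i ∈ s, (mvfderiv 𝓘(ℝ, Euc n) (a i) m (X m) * g.inner m (F i m) (Z m)
        + a i m * koszul g X (F i) Z m) := by
  have h1 := koszul_add_koszul_swap g X (fun y => ∑ i ∈ s, a i y • F i y) Z m
  rw [koszul_sum_right s hX hZ hF ha, mvfderiv_inner_sum s hZ hF ha] at h1
  rw [eq_sub_of_add_eq h1, ← Finset.sum_sub_distrib]
  refine Finset.sum_congr rfl fun i _ => ?_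
  rw [← koszul_add_koszul_swap g X (F i) Z m]
  ring

lemma mlieBracket_sum_left (Y : VField n M) (s : Finset ι)
    (hF : ∀ i, DiffField (F i) m) (ha : ∀ i, DiffFun (n := n) (a i) m) :
    VectorField.mlieBracket 𝓘(ℝ, Euc n) (fun y => ∑ i ∈ s, a i y • F i y) Y m
      = ∑ i ∈ s, (a i m • VectorField.mlieBracket 𝓘(ℝ, Euc n) (F i) Y m
        - mvfderiv 𝓘(ℝ, Euc n) (a i) m (Y m) • F i m) := by
  have := isManifold_two (n := n) (M := M)
  classical
  induction s using Finset.induction_on with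
  | empty =>
    simp only [Finset.sum_empty]
    exact congrFun (VectorField.mlieBracket_zero_left (W := Y)) m
  | insert i s hi ih =>
    simp only [Finset.sum_insert hi]
    have h1 := VectorField.mlieBracket_add_left (W := Y) (V := fun y => a i y • F i y)
      (V₁ := fun y => ∑ i ∈ s, a i y • F i y) ((hF i).smul (ha i))
      (DiffField.sum s fun j _ => (hF j).smul (ha j))
    refine h1.trans ?_
    rw [ih]
    congr 1
    refine (VectorField.mlieBracket_smul_left (W := Y) (ha i) (hF i)).trans ?_
    rw [neg_smul]
    abel

lemma mlieBracket_sum_right (Y : VField n M) (s : Finset ι)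
    (hF : ∀ i, DiffField (F i) m) (ha : ∀ i, DiffFun (n := n) (a i) m) :
    VectorField.mlieBracket 𝓘(ℝ, Euc n) Y (fun y => ∑ i ∈ s, a i y • F i y) m
      = ∑ i ∈ s, (a i m • VectorField.mlieBracket 𝓘(ℝ, Euc n) Y (F i) m
        + mvfderiv 𝓘(ℝ, Euc n) (a i) m (Y m) • F i m) := by
  rw [VectorField.mlieBracket_swap_apply, mlieBracket_sum_left _ s hF ha,
    ← Finset.sum_neg_distrib]
  refine Finset.sum_congr rfl fun i _ => ?_
  rw [VectorField.mlieBracket_swap_apply (V := Y) (W := F i), smul_neg]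
  abel

/-- Torsion-freeness moves the sum to the middle slot; the derivatives of the coefficients arising
there cancel those from the Lie bracket. -/
lemma koszul_sum_left (s : Finset ι) (hY : DiffField Y m) (hZ : DiffField Z m)
    (hF : ∀ i, DiffField (F i) m) (ha : ∀ i, DiffFun (n := n) (a i) m) :
    koszul g (fun y => ∑ i ∈ s, a i y • F i y) Y Z m = ∑ i ∈ s, a i m * koszul g (F i) Y Z m := by
  have h1 := koszul_sub_koszul_swap g (fun y => ∑ i ∈ s, a i y • F i y) Y Z m
  rw [koszul_sum_middle s hY hZ hF ha, mlieBracket_sum_left _ s hF ha] at h1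
  rw [eq_add_of_sub_eq h1, map_sum, sum_apply, ← Finset.sum_add_distrib]
  refine Finset.sum_congr rfl fun i _ => ?_
  have h2 := koszul_sub_koszul_swap g (F i) Y Z m
  simp only [map_sub, map_smul, sub_apply, smul_apply, smul_eq_mul, ← h2]
  ring

end Koszul

/-! ### Bivectors under conjugation and in the spinor module. -/

section BivectorAction

variable {n : ℕ} {S : Type*} [NormedAddCommGroup S] [NormedSpace ℂ S]

/-- Conjugation by `h` is multiplicative and rotates each generator by `Ad h`, so it acts on the
coefficient matrix by congruence with `adMat h`. -/
lemma mul_bivec (h : Spin n) (K : Fin n → Fin n → ℝ) :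
    (h : Cl n) * bivec K
      = bivec (fun l p => ∑ j, ∑ k, adMat h j l * adMat h k p * K j k) * (h : Cl n) := by
  have h1 : (h : Cl n) * bivec K * ((h⁻¹ : Spin n) : Cl n)
      = bivec (fun l p => ∑ j, ∑ k, adMat h j l * adMat h k p * K j k) := by
    have h2 : ∀ j k, (h : Cl n) * (gen j * gen k) * ((h⁻¹ : Spin n) : Cl n)
        = ∑ l, ∑ p, (adMat h j l * adMat h k p) • (gen l * gen p) := by
      intro j k
      calc _ = ((h : Cl n) * gen j * ((h⁻¹ : Spin n) : Cl n))
            * ((h : Cl n) * gen k * ((h⁻¹ : Spin n) : Cl n)) := by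
            simp only [mul_assoc]
            rw [← mul_assoc ((h⁻¹ : Spin n) : Cl n) (h : Cl n), spin_inv_mul, one_mul]
        _ = _ := by
            rw [← vec_Ad_stdVec, ← vec_Ad_stdVec, Finset.sum_mul_sum]
            refine Finset.sum_congr rfl fun l _ => Finset.sum_congr rfl fun p _ => ?_
            rw [smul_mul_assoc, mul_smul_comm, smul_smul]
    simp only [bivec, mul_smul_comm, smul_mul_assoc, Finset.mul_sum, Finset.sum_mul, h2,
      Finset.smul_sum, Finset.sum_smul, smul_smul]
    have h3 := fun (F : Fin n → Fin n → Fin n → Fin n → Cl n) => calc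
      ∑ j, ∑ k, ∑ l, ∑ p, F j k l p = ∑ j, ∑ l, ∑ k, ∑ p, F j k l p :=
        Finset.sum_congr rfl fun j _ => Finset.sum_comm
      _ = ∑ l, ∑ j, ∑ k, ∑ p, F j k l p := Finset.sum_comm
      _ = ∑ l, ∑ j, ∑ p, ∑ k, F j k l p :=
        Finset.sum_congr rfl fun l _ => Finset.sum_congr rfl fun j _ => Finset.sum_comm
      _ = ∑ l, ∑ p, ∑ j, ∑ k, F j k l p := Finset.sum_congr rfl fun l _ => Finset.sum_comm
    rw [h3]
    refine Finset.sum_congr rfl fun l _ => Finset.sum_congr rfl fun p _ =>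
      Finset.sum_congr rfl fun j _ => Finset.sum_congr rfl fun k _ => ?_
    congr 1
    ring
  rw [← h1, mul_assoc, spin_inv_mul, mul_one]

lemma bivec_add (A B : Fin n → Fin n → ℝ) :
    bivec (fun p l => A p l + B p l) = bivec A + bivec B := by
  simp only [bivec, add_smul, Finset.sum_add_distrib, smul_add]

lemma bivec_smul_sum {ι : Type*} (s : Finset ι) (c : ι → ℝ) (A : ι → Fin n → Fin n → ℝ) :
    bivec (fun p l => ∑ i ∈ s, c i * A i p l) = ∑ i ∈ s, c i • bivec (A i) := by
  classical
  induction s using Finset.induction_on with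
  | empty => simp [bivec]
  | insert i s hi ih =>
    simp only [Finset.sum_insert hi]
    rw [bivec_add, ih]
    congr 1
    simp only [bivec, Finset.smul_sum, smul_smul]
    refine Finset.sum_congr rfl fun _ _ => Finset.sum_congr rfl fun _ _ => ?_
    congr 1
    ring

/-- The representation as a real bilinear map. -/
def SpinorModule.bilin (ρ : SpinorModule n S) : Cl n →ₗ[ℝ] S →ₗ[ℝ] S :=
  LinearMap.mk₂ ℝ (fun a φ => ρ.c a φ) (by intros; simp)
    (by intro r a φ; rw [map_smul]; rfl)
    (by intros; simp)
    (by intro r a φ; exact (ρ.c a).map_smul_of_tower r φ)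

lemma SpinorModule.bilin_apply (ρ : SpinorModule n S) (a : Cl n) (φ : S) :
    ρ.bilin a φ = ρ.c a φ := rfl

lemma SpinorModule.bilin_mul (ρ : SpinorModule n S) (a b : Cl n) (φ : S) :
    ρ.bilin (a * b) φ = ρ.bilin a (ρ.bilin b φ) := by
  simp only [SpinorModule.bilin_apply, map_mul, Module.End.mul_apply]

lemma SpinorModule.bilin_bivec (ρ : SpinorModule n S) (K : Fin n → Fin n → ℝ) (φ : S) :
    (1 / 4 : ℝ) • ∑ j, ∑ k, K j k • ρ.c (vec (stdVec j) * vec (stdVec k)) φ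
      = ρ.bilin (bivec K) φ := by
  simp only [bivec, map_smul, map_sum, LinearMap.smul_apply, LinearMap.sum_apply]
  rfl

end BivectorAction

/-! ### Independence of the connection and the Dirac operator from the local section. -/

section Connection

variable {n : ℕ} {M : Type*} [TopologicalSpace M] [ChartedSpace (Euc n) M]
  [IsManifold 𝓘(ℝ, Euc n) ∞ M] {m : M} {g : Metric n M} {o : OrientationField n M}
  {S : Type*} [NormedAddCommGroup S] [NormedSpace ℂ S]
  {s : SpinStructure g o} {ρ : SpinorModule n S}

lemma inner_frameField (q : ∀ y, s.P y) (i j : Fin n) (y : M) :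
    g.inner y (frameField s q i y) (frameField s q j y) = if i = j then 1 else 0 := by
  rw [← inner_stdVec]
  exact (s.σ (q y)).isometry _ _

lemma frameField_act {q q' : ∀ y, s.P y} {y : M} {h : Spin n} (hq : q y = s.act (q' y) h)
    (j : Fin n) : frameField s q j y = ∑ l, adMat h j l • frameField s q' l y := by
  simp only [frameField]
  rw [hq, s.σ_act, Ad_stdVec, map_sum]
  simp_rw [map_smul]

lemma diffField_frameField_sec (m : M) (i : Fin n) : DiffField (frameField s (s.sec m) i) m :=
  (s.smooth_frame m (stdVec i)).diffField ((s.isOpen_dom m).mem_nhds (s.mem_dom m))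

lemma mk_component (q : ∀ y, s.P y) (ψ : SpinorField s ρ) (y : M) :
    Spinor.mk s ρ (q y) (component s ρ q ψ y) = ψ y :=
  (Spinor.linEquiv s ρ (q y)).apply_symm_apply (ψ y)

lemma component_eq_iff (q : ∀ y, s.P y) (ψ : SpinorField s ρ) (y : M) (φ : S) :
    component s ρ q ψ y = φ ↔ ψ y = Spinor.mk s ρ (q y) φ :=
  (Spinor.linEquiv s ρ (q y)).symm_apply_eq

/-- The component of `∇_X ψ` in the local section `q`. -/
def nablaComponent (ρ : SpinorModule n S) (q : ∀ y, s.P y) (X : VField n M) (ψ : SpinorField s ρ)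
    (x : M) : S :=
  mvfderiv 𝓘(ℝ, Euc n) (component s ρ q ψ) x (X x)
    + ρ.bilin (bivec fun j k => koszul g X (frameField s q j) (frameField s q k) x)
      (component s ρ q ψ x)

lemma spinorNablaIn_eq_mk (q : ∀ y, s.P y) (X : VField n M) (ψ : SpinorField s ρ) (x : M) :
    spinorNablaIn s ρ q X ψ x = Spinor.mk s ρ (q x) (nablaComponent ρ q X ψ x) := by
  rw [spinorNablaIn, SpinorModule.bilin_bivec, nablaComponent]

lemma cliffordMul_frameField (q : ∀ y, s.P y) (i : Fin n) (x : M) (φ : S) :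
    cliffordMul s ρ x (frameField s q i x) (Spinor.mk s ρ (q x) φ)
      = Spinor.mk s ρ (q x) (ρ.bilin (gen i) φ) := by
  rw [cliffordMul_mk, frameField, LinearEquiv.symm_apply_apply]
  rfl

lemma mk_sum {x : M} (p : s.P x) {ι : Type*} (t : Finset ι) (φ : ι → S) :
    Spinor.mk s ρ p (∑ i ∈ t, φ i) = ∑ i ∈ t, Spinor.mk s ρ p (φ i) :=
  map_sum (Spinor.linEquiv s ρ p) φ t

lemma mk_add {x : M} (p : s.P x) (φ χ : S) :
    Spinor.mk s ρ p (φ + χ) = Spinor.mk s ρ p φ + Spinor.mk s ρ p χ :=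
  map_add (Spinor.linEquiv s ρ p) φ χ

lemma mk_smul {x : M} (p : s.P x) (r : ℝ) (φ : S) :
    Spinor.mk s ρ p (r • φ) = r • Spinor.mk s ρ p φ :=
  ((Spinor.linEquiv s ρ p).toLinearMap.restrictScalars ℝ).map_smul r φ

/-- A section `q` of the spin structure is differentiable at `m` if it differs from the preferred
section by a differentiable `Spin(n)`-valued function `h` near `m`. -/
structure IsDiffSection (s : SpinStructure g o) (m : M) (q : ∀ y, s.P y) (h : M → Spin n) :
    Prop where
  eq_act : ∀ᶠ y in 𝓝 m, q y = s.act (s.sec m y) (h y)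
  diff : ∀ l : Cl n →ₗ[ℝ] ℝ, DiffFun (n := n) (fun y => l (h y : Cl n)) m

variable {q : ∀ y, s.P y} {h : M → Spin n}

lemma IsDiffSection.diffFun_adMat (hq : IsDiffSection s m q h) (j l : Fin n) :
    DiffFun (n := n) (fun y => adMat (h y) j l) m := by
  obtain ⟨h', hh'⟩ := exists_hasDirDeriv (X := (0 : Tan n m)) hq.diff
  obtain ⟨a', ha', -⟩ := hh'.spin
  exact (hasDirDeriv_real_iff.mp (ha' j l)).1

lemma IsDiffSection.frameField_eventually (hq : IsDiffSection s m q h) (j : Fin n) :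
    ∀ᶠ y in 𝓝 m, frameField s q j y = ∑ l, adMat (h y) j l • frameField s (s.sec m) l y := by
  filter_upwards [hq.eq_act] with y hy
  exact frameField_act hy j

lemma IsDiffSection.diffField_frameField (hq : IsDiffSection s m q h) (j : Fin n) :
    DiffField (frameField s q j) m :=
  (DiffField.sum _ fun l _ => (diffField_frameField_sec m l).smul (hq.diffFun_adMat j l)).congr
    (hq.frameField_eventually j)

/-- The change of connection coefficients between frames: the Leibniz rule in the middle slot
creates the inhomogeneous term, and orthonormality of the preferred frame evaluates it. -/
lemma IsDiffSection.koszul_frameField (hq : IsDiffSection s m q h) {X : VField n M}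
    (hX : DiffField X m) (j k : Fin n) :
    koszul g X (frameField s q j) (frameField s q k) m
      = (∑ l, mvfderiv 𝓘(ℝ, Euc n) (fun y => adMat (h y) j l) m (X m) * adMat (h m) k l)
        + ∑ l, ∑ p, adMat (h m) j l * adMat (h m) k p *
          koszul g X (frameField s (s.sec m) l) (frameField s (s.sec m) p) m := by
  have hs := fun l => diffField_frameField_sec (s := s) m l
  rw [koszul_congr (Filter.Eventually.of_forall fun _ => rfl) (hq.frameField_eventually j)
    (Filter.Eventually.of_forall fun _ => rfl),
    koszul_sum_middle _ hX (hq.diffField_frameField k) hs (hq.diffFun_adMat j),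
    Finset.sum_add_distrib]
  congr 1
  · refine Finset.sum_congr rfl fun l _ => ?_
    congr 1
    rw [(hq.frameField_eventually k).self_of_nhds, map_sum]
    simp [inner_frameField]
  · refine Finset.sum_congr rfl fun l _ => ?_
    rw [koszul_congr (Filter.Eventually.of_forall fun _ => rfl)
      (Filter.Eventually.of_forall fun _ => rfl) (hq.frameField_eventually k),
      koszul_sum_right _ hX (hs l) hs (hq.diffFun_adMat k), Finset.mul_sum]
    refine Finset.sum_congr rfl fun p _ => ?_
    ring

variable [FiniteDimensional ℂ S] {ψ : SpinorField s ρ}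

/-- The gauge transformation law of the spinorial connection. -/
lemma IsDiffSection.nablaComponent_sec (hq : IsDiffSection s m q h) {X : VField n M}
    (hX : DiffField X m)
    (hψ : MDifferentiableAt 𝓘(ℝ, Euc n) 𝓘(ℝ, S) (component s ρ q ψ) m) :
    nablaComponent ρ (s.sec m) X ψ m
      = ρ.bilin (h m : Cl n) (nablaComponent ρ q X ψ m) := by
  have : FiniteDimensional ℝ S := FiniteDimensional.complexToReal S
  obtain ⟨h', hh'⟩ := exists_hasDirDeriv (X := X m) hq.diff
  obtain ⟨a', ha', hh''⟩ := hh'.spin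
  -- `[sec · h, φ] = [sec, ρ(h) φ]`: the components differ by `ρ(h)`.
  have hcomp : component s ρ (s.sec m) ψ =ᶠ[𝓝 m]
      fun y => ρ.bilin (h y : Cl n) (component s ρ q ψ y) := by
    filter_upwards [hq.eq_act] with y hy
    rw [component_eq_iff]
    rw [SpinorModule.bilin_apply, ← Spinor.mk_act, ← hy, mk_component]
  have hd := ((hh'.bilin ρ.bilin (hasDirDeriv_of_mdifferentiableAt (X := X m) hψ)).congr hcomp)
  rw [hasDirDeriv_iff] at hd
  have hK : ∀ j k, koszul g X (frameField s q j) (frameField s q k) m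
      = (∑ l, a' j l * adMat (h m) k l)
        + ∑ l, ∑ p, adMat (h m) j l * adMat (h m) k p *
          koszul g X (frameField s (s.sec m) l) (frameField s (s.sec m) p) m := by
    intro j k
    rw [hq.koszul_frameField hX j k]
    congr 1
    refine Finset.sum_congr rfl fun l _ => ?_
    rw [(hasDirDeriv_real_iff.mp (ha' j l)).2]
  -- The gauge law `h' + ω_sec h = h ω_q` for the connection elements. Moving `h` to the right on
  -- the other side conjugates `ω_q`; its inhomogeneous part becomes `h' h⁻¹`, and orthogonality
  -- undoes the rotation in the remaining part.
  have key : h' + bivec (fun j k => koszul g X (frameField s (s.sec m) j)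
        (frameField s (s.sec m) k) m) * (h m : Cl n)
      = (h m : Cl n) * bivec fun j k => koszul g X (frameField s q j) (frameField s q k) m := by
    rw [mul_bivec, hh'', ← add_mul, ← bivec_add]
    simp only [hK]
    congr 2
    ext l p
    simp only [mul_add, Finset.sum_add_distrib]
    congr 1
    · refine Finset.sum_congr rfl fun j _ => ?_
      have h1 : ∀ r, ∑ k, adMat (h m) k p * adMat (h m) k r = if p = r then 1 else 0 :=
        fun r => adMat_transpose_mul (h m) p r
      calc _ = ∑ r, adMat (h m) j l * a' j r * ∑ k, adMat (h m) k p * adMat (h m) k r := by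
            simp [h1]
        _ = _ := by
            simp_rw [Finset.mul_sum]
            rw [Finset.sum_comm]
            refine Finset.sum_congr rfl fun k _ => Finset.sum_congr rfl fun r _ => ?_
            ring
    · have h1 : ∀ p r, ∑ k, adMat (h m) k p * adMat (h m) k r = if p = r then 1 else 0 :=
        fun p r => adMat_transpose_mul (h m) p r
      symm
      calc _ = ∑ j, ∑ k, ∑ r, ∑ t, (adMat (h m) j l * adMat (h m) j r) *
              (adMat (h m) k p * adMat (h m) k t) *
              koszul g X (frameField s (s.sec m) r) (frameField s (s.sec m) t) m := by
            simp_rw [Finset.mul_sum]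
            refine Finset.sum_congr rfl fun j _ => Finset.sum_congr rfl fun k _ =>
              Finset.sum_congr rfl fun r _ => Finset.sum_congr rfl fun t _ => ?_
            ring
        _ = ∑ r, ∑ t, (∑ j, adMat (h m) j l * adMat (h m) j r) *
              (∑ k, adMat (h m) k p * adMat (h m) k t) *
              koszul g X (frameField s (s.sec m) r) (frameField s (s.sec m) t) m := by
            simp_rw [Finset.sum_mul_sum, Finset.sum_mul]
            calc _ = ∑ j, ∑ r, ∑ k, ∑ t, (adMat (h m) j l * adMat (h m) j r) *
                  (adMat (h m) k p * adMat (h m) k t) *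
                  koszul g X (frameField s (s.sec m) r) (frameField s (s.sec m) t) m :=
                  Finset.sum_congr rfl fun j _ => Finset.sum_comm
              _ = ∑ r, ∑ j, ∑ k, ∑ t, (adMat (h m) j l * adMat (h m) j r) *
                  (adMat (h m) k p * adMat (h m) k t) *
                  koszul g X (frameField s (s.sec m) r) (frameField s (s.sec m) t) m :=
                  Finset.sum_comm
              _ = ∑ r, ∑ j, ∑ t, ∑ k, (adMat (h m) j l * adMat (h m) j r) *
                  (adMat (h m) k p * adMat (h m) k t) *
                  koszul g X (frameField s (s.sec m) r) (frameField s (s.sec m) t) m :=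
                  Finset.sum_congr rfl fun r _ => Finset.sum_congr rfl fun j _ =>
                    Finset.sum_comm
              _ = _ := Finset.sum_congr rfl fun r _ => Finset.sum_comm
        _ = _ := by simp [h1]
  rw [nablaComponent, hd.2, hcomp.self_of_nhds, nablaComponent, map_add, ← ρ.bilin_mul,
    ← ρ.bilin_mul, ← key, map_add, LinearMap.add_apply]
  abel

/-- The Dirac operator computed in an arbitrary differentiable section. -/
lemma IsDiffSection.dirac_eq (hq : IsDiffSection s m q h)
    (hψ : MDifferentiableAt 𝓘(ℝ, Euc n) 𝓘(ℝ, S) (component s ρ q ψ) m) :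
    dirac s ρ ψ m
      = Spinor.mk s ρ (q m) (∑ i, ρ.bilin (gen i) (nablaComponent ρ q (frameField s q i) ψ m)) := by
  have hs := fun l => diffField_frameField_sec (s := s) m l
  -- The covariant derivative is tensorial in the direction.
  have hlin : ∀ i, nablaComponent ρ (s.sec m) (frameField s q i) ψ m
      = ∑ l, adMat (h m) i l •
        nablaComponent ρ (s.sec m) (frameField s (s.sec m) l) ψ m := by
    intro i
    simp only [nablaComponent, smul_add, Finset.sum_add_distrib]
    congr 1
    · rw [(hq.frameField_eventually i).self_of_nhds, map_sum]
      simp_rw [map_smul]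
    · have : (fun j k => koszul g (frameField s q i) (frameField s (s.sec m) j)
            (frameField s (s.sec m) k) m) = fun j k => ∑ l, adMat (h m) i l *
            koszul g (frameField s (s.sec m) l) (frameField s (s.sec m) j)
            (frameField s (s.sec m) k) m := by
        ext j k
        rw [koszul_congr (hq.frameField_eventually i) (Filter.Eventually.of_forall fun _ => rfl)
          (Filter.Eventually.of_forall fun _ => rfl),
          koszul_sum_left _ (hs j) (hs k) hs (hq.diffFun_adMat i)]
      rw [this, bivec_smul_sum, map_sum, LinearMap.sum_apply]
      simp_rw [map_smul, LinearMap.smul_apply]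
  rw [hq.eq_act.self_of_nhds, Spinor.mk_act, ← ρ.bilin_apply, map_sum]
  simp only [dirac, spinorNabla, spinorNablaIn_eq_mk, cliffordMul_frameField, ← mk_sum]
  congr 1
  -- `h e_i = (Ad h e_i) h` and the gauge law bring both factors to the preferred frame. Each
  -- carries a factor `adMat (h m) i _`, so summing over `i` leaves the diagonal terms.
  have h1 : ∀ i, ρ.bilin (h m : Cl n) (ρ.bilin (gen i)
        (nablaComponent ρ q (frameField s q i) ψ m))
      = ∑ l, ∑ p, (adMat (h m) i l * adMat (h m) i p) •
        ρ.bilin (gen l) (nablaComponent ρ (s.sec m) (frameField s (s.sec m) p) ψ m) := by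
    intro i
    have h2 : (h m : Cl n) * gen i = (∑ l, adMat (h m) i l • gen l) * (h m : Cl n) := by
      rw [vec_Ad_stdVec, mul_assoc, spin_inv_mul, mul_one]
    rw [← ρ.bilin_mul, h2, ρ.bilin_mul, ← hq.nablaComponent_sec (hq.diffField_frameField i) hψ,
      hlin i]
    simp only [map_sum, map_smul, LinearMap.sum_apply, LinearMap.smul_apply, Finset.smul_sum,
      smul_smul]
    rw [Finset.sum_comm]
    simp_rw [mul_comm]
  simp_rw [h1]
  rw [Finset.sum_comm]
  refine Finset.sum_congr rfl fun l _ => ?_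
  rw [Finset.sum_comm]
  simp_rw [← Finset.sum_smul, adMat_transpose_mul]
  simp

end Connection

/-! ### The flat spin structure, where the connection coefficients vanish. -/

section Flat

variable {n : ℕ} {S : Type*} [NormedAddCommGroup S] [NormedSpace ℂ S] {ρ : SpinorModule n S}

lemma diffField_constField (v : Euc n) (y : Euc n) : DiffField (constField v) y := by
  refine (mdifferentiableAt_section _ _).mpr ?_
  convert! mdifferentiableAt_const (c := v)
  simp [constField]

lemma DiffField.mdifferentiableAt_vectorSpace {X : VField n (Euc n)} {y : Euc n}
    (hX : DiffField X y) :
    MDifferentiableAt 𝓘(ℝ, Euc n) 𝓘(ℝ, Euc n) (fun z => (X z : Euc n)) y := by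
  have := (mdifferentiableAt_section _ _).mp hX
  convert! this
  simp

lemma mlieBracket_constField (u v : Euc n) (y : Euc n) :
    VectorField.mlieBracket 𝓘(ℝ, Euc n) (constField u) (constField v) y = 0 := by
  rw [← VectorField.mlieBracketWithin_univ, VectorField.mlieBracketWithin_eq_lieBracketWithin]
  have h : ∀ w : Euc n, fderivWithin ℝ (fun _ : Euc n => w) Set.univ y = 0 := fun w =>
    fderivWithin_const_apply w
  change fderivWithin ℝ (fun _ : Euc n => v) Set.univ y u
    - fderivWithin ℝ (fun _ : Euc n => u) Set.univ y v = 0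
  rw [h, h]
  simp

lemma koszul_flatMetric_constField (u v w : Euc n) (y : Euc n) :
    koszul (flatMetric n) (constField u) (constField v) (constField w) y = 0 := by
  have h : ∀ a b : Euc n, mvfderiv 𝓘(ℝ, Euc n)
      (fun z => (flatMetric n).inner z (constField a z) (constField b z)) y = 0 :=
    fun a b => mvfderiv_const (inner ℝ a b)
  simp only [koszul, mlieBracket_constField, h]
  simp

/-- The constant section of the flat spin structure. -/
abbrev flatSec (n : ℕ) : ∀ y : Euc n, (flatSpin n).P y := fun _ => (1 : Spin n)

lemma frameField_flatSec (i : Fin n) :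
    frameField (flatSpin n) (flatSec n) i = constField (stdVec i) :=
  funext fun _ => Ad_one (stdVec i)

lemma spinorNabla_flat (v : Euc n) (ψ : SpinorField (flatSpin n) ρ) (y : Euc n) :
    spinorNabla (flatSpin n) ρ (constField v) ψ y
      = Spinor.mk (flatSpin n) ρ (flatSec n y)
        (mvfderiv 𝓘(ℝ, Euc n) (component (flatSpin n) ρ (flatSec n) ψ) y v) := by
  refine (spinorNablaIn_eq_mk (flatSec n) _ ψ y).trans ?_
  have h : bivec (fun j k => koszul (flatMetric n) (constField v)
      (frameField (flatSpin n) (flatSec n) j) (frameField (flatSpin n) (flatSec n) k) y) = 0 := by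
    simp only [frameField_flatSec, koszul_flatMetric_constField]
    simp [bivec]
  rw [nablaComponent, h, map_zero, LinearMap.zero_apply, add_zero]
  rfl

lemma cliffordMul_flat (i : Fin n) (y : Euc n) (χ : S) :
    cliffordMul (flatSpin n) ρ y (stdVec i) (Spinor.mk (flatSpin n) ρ (flatSec n y) χ)
      = Spinor.mk (flatSpin n) ρ (flatSec n y) (ρ.bilin (gen i) χ) := by
  have := cliffordMul_frameField (ρ := ρ) (flatSec n) i y χ
  rwa [frameField_flatSec] at this

lemma dirac_flat (ψ : SpinorField (flatSpin n) ρ) (y : Euc n) :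
    dirac (flatSpin n) ρ ψ y
      = Spinor.mk (flatSpin n) ρ (flatSec n y) (∑ i, ρ.bilin (gen i)
        (mvfderiv 𝓘(ℝ, Euc n) (component (flatSpin n) ρ (flatSec n) ψ) y (stdVec i))) := by
  rw [mk_sum]
  refine Finset.sum_congr rfl fun i _ => ?_
  have h : frameField (flatSpin n) ((flatSpin n).sec y) i = constField (stdVec i) :=
    frameField_flatSec i
  rw [h, spinorNabla_flat]
  exact cliffordMul_flat i y _

end Flat

/-! ### Coordinate vector fields. -/

section NormalCoordinates

variable {n : ℕ} {M : Type*} [TopologicalSpace M] [ChartedSpace (Euc n) M]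
  [IsManifold 𝓘(ℝ, Euc n) ∞ M] {m : M} {g : Metric n M} {o : OrientationField n M} {p : M}

namespace NormalCoordinates

variable (x : NormalCoordinates g o p)

lemma mdifferentiable_coord : x.coord.MDifferentiable 𝓘(ℝ, Euc n) 𝓘(ℝ, Euc n) :=
  ⟨x.smooth_coord.mdifferentiableOn (by simp), x.smooth_symm.mdifferentiableOn (by simp)⟩

lemma contMDiffAt_coord (hm : m ∈ x.coord.source) :
    ContMDiffAt 𝓘(ℝ, Euc n) 𝓘(ℝ, Euc n) ∞ x.coord m :=
  x.smooth_coord.contMDiffAt (x.coord.open_source.mem_nhds hm)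

lemma isInvertible_mfderiv_coord (hm : m ∈ x.coord.source) :
    (mfderiv 𝓘(ℝ, Euc n) 𝓘(ℝ, Euc n) x.coord m).IsInvertible :=
  ⟨x.mdifferentiable_coord.mfderiv hm, rfl⟩

lemma isInvertible_mfderiv_coord_symm {z : Euc n} (hz : z ∈ x.coord.target) :
    (mfderiv 𝓘(ℝ, Euc n) 𝓘(ℝ, Euc n) x.coord.symm z).IsInvertible :=
  ⟨x.mdifferentiable_coord.symm.mfderiv hz, rfl⟩

lemma mfderiv_coord_partialField (hm : m ∈ x.coord.source) (i : Fin n) :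
    mfderiv 𝓘(ℝ, Euc n) 𝓘(ℝ, Euc n) x.coord m (x.partialField i m) = stdVec i := by
  have h : (mfderiv 𝓘(ℝ, Euc n) 𝓘(ℝ, Euc n) x.coord m).inverse
      = (x.mdifferentiable_coord.mfderiv hm).symm :=
    ContinuousLinearMap.inverse_equiv (x.mdifferentiable_coord.mfderiv hm)
  rw [partialField, VectorField.mpullback_apply, h]
  exact (x.mdifferentiable_coord.mfderiv hm).apply_symm_apply _

lemma diffField_partialField (hm : m ∈ x.coord.source) (i : Fin n) :
    DiffField (x.partialField i) m := by
  have := isManifold_two (n := n) (M := M)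
  exact MDifferentiableAt.mpullback_vectorField (n := ∞) (diffField_constField _ _)
    (x.contMDiffAt_coord hm) (x.isInvertible_mfderiv_coord hm) (by norm_cast)

/-- Lie brackets are natural under pullback, and constant fields commute. -/
lemma mlieBracket_partialField (hm : m ∈ x.coord.source) (i j : Fin n) :
    VectorField.mlieBracket 𝓘(ℝ, Euc n) (x.partialField i) (x.partialField j) m = 0 := by
  have : IsManifold 𝓘(ℝ, Euc n) (minSmoothness ℝ 2) M := by
    rw [minSmoothness_of_isRCLikeNormedField]
    exact isManifold_two
  have h := VectorField.mpullback_mlieBracket (n := ∞) (I := 𝓘(ℝ, Euc n)) (I' := 𝓘(ℝ, Euc n))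
    (f := x.coord) (x₀ := m) (V := constField (stdVec i)) (W := constField (stdVec j))
    (diffField_constField _ _) (diffField_constField _ _) (x.contMDiffAt_coord hm)
    (by rw [minSmoothness_of_isRCLikeNormedField]; norm_cast)
  refine h.symm.trans ?_
  rw [VectorField.mpullback_apply, mlieBracket_constField, map_zero]

/-- The coefficients of a differentiable vector field in normal coordinates are differentiable. -/
lemma diffFun_coefficient (hm : m ∈ x.coord.source) {X : VField n M} (hX : DiffField X m)
    {b : M → Fin n → ℝ} (hb : ∀ y ∈ x.coord.source, X y = ∑ j, b y j • x.partialField j y)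
    (j : Fin n) : DiffFun (n := n) (fun y => b y j) m := by
  have := isManifold_two (n := n) (M := M)
  have hz := x.coord.map_source hm
  have hs : x.coord.symm (x.coord m) = m := x.coord.left_inv hm
  -- Transported to `ℝⁿ` by the inverse chart, the field has the `b y j` as its Cartesian
  -- components.
  have h1 : DiffField (VectorField.mpullback 𝓘(ℝ, Euc n) 𝓘(ℝ, Euc n) x.coord.symm X)
      (x.coord m) := by
    refine MDifferentiableAt.mpullback_vectorField (n := ∞) ?_
      (x.smooth_symm.contMDiffAt (x.coord.open_target.mem_nhds hz))
      (x.isInvertible_mfderiv_coord_symm hz) (by norm_cast)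
    rw [hs]
    exact hX
  have h2 := h1.mdifferentiableAt_vectorSpace.comp m
    ((x.contMDiffAt_coord hm).mdifferentiableAt (by simp))
  have h3 := (hasDirDeriv_of_mdifferentiableAt (X := (0 : Tan n m)) h2).comp
    (EuclideanSpace.proj j : Euc n →L[ℝ] ℝ).toLinearMap
  refine (hasDirDeriv_real_iff.mp (h3.congr ?_)).1
  filter_upwards [x.coord.open_source.mem_nhds hm] with y hy
  have hy' := x.coord.map_source hy
  have h4 : (VectorField.mpullback 𝓘(ℝ, Euc n) 𝓘(ℝ, Euc n) x.coord.symm X (x.coord y) : Euc n)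
      = ∑ j, b y j • stdVec j := by
    rw [VectorField.mpullback_apply]
    have h5 : (mfderiv 𝓘(ℝ, Euc n) 𝓘(ℝ, Euc n) x.coord.symm (x.coord y)).inverse
        = mfderiv 𝓘(ℝ, Euc n) 𝓘(ℝ, Euc n) x.coord (x.coord.symm (x.coord y)) :=
      ContinuousLinearMap.inverse_equiv (x.mdifferentiable_coord.symm.mfderiv hy')
    rw [h5, x.coord.left_inv hy, hb y hy, map_sum]
    refine Finset.sum_congr rfl fun j _ => ?_
    rw [map_smul, x.mfderiv_coord_partialField hy]
    rfl
  refine Eq.trans ?_ (congrArg (fun v : Euc n => v j) h4).symm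
  simp [stdVec, Pi.single_apply]

end NormalCoordinates

end NormalCoordinates

/-! ### The section and the frame given by the Bourguignon–Gauduchon lift. -/

section BG

variable {n : ℕ} {M : Type*} [TopologicalSpace M] [ChartedSpace (Euc n) M]
  [IsManifold 𝓘(ℝ, Euc n) ∞ M] {m : M} {g : Metric n M} {o : OrientationField n M} {p : M}
  {s : SpinStructure g o} {x : NormalCoordinates g o p}
  {S : Type*} [NormedAddCommGroup S] [NormedSpace ℂ S] {ρ : SpinorModule n S}

namespace BGLift

open Classical in
/-- The image under `η̄` of the constant section, extended arbitrarily outside of `V`. -/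
def sec (η : BGLift s x) : ∀ y, s.P y := fun y =>
  if hy : y ∈ x.coord.source then η.toFun y hy (flatSec n (x.coord y)) else s.sec y y

lemma sec_of_mem (η : BGLift s x) {y : M} (hy : y ∈ x.coord.source) :
    η.sec y = η.toFun y hy (flatSec n (x.coord y)) := dif_pos hy

lemma frameField_sec (η : BGLift s x) {y : M} (hy : y ∈ x.coord.source) (i : Fin n) :
    frameField s η.sec i y = x.e i y := by
  rw [frameField, η.sec_of_mem hy, η.covers, NormalCoordinates.e]
  have h : ∀ k, (show Euc n from ((flatSpin n).σ (flatSec n (x.coord y))).toLin (stdVec i)) k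
      = if k = i then 1 else 0 := by
    intro k
    have : (((flatSpin n).σ (flatSec n (x.coord y))).toLin (stdVec i) : Euc n) = stdVec i :=
      Ad_one (stdVec i)
    refine (congrArg (fun v : Euc n => v k) this).trans ?_
    simp [stdVec]
  simp only [h]
  simp

lemma frameField_sec_eventually (η : BGLift s x) (hm : m ∈ x.coord.source) (i : Fin n) :
    ∀ᶠ y in 𝓝 m, x.e i y = frameField s η.sec i y := by
  filter_upwards [x.coord.open_source.mem_nhds hm] with y hy
  exact (η.frameField_sec hy i).symm

/-- Simple transitivity supplies `h`, and smoothness of the lift its differentiability; the gauge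
laws then apply to `η.sec`. -/
lemma exists_isDiffSection (η : BGLift s x) (hm : m ∈ x.coord.source) :
    ∃ h, IsDiffSection s m η.sec h := by
  choose h hh _ using fun y => s.simply_transitive (s.sec m y) (η.sec y)
  refine ⟨h, Filter.Eventually.of_forall fun y => (hh y).symm, fun l => ?_⟩
  have h1 := η.smooth m h (fun y hy _ => by
    rw [hh y, η.sec_of_mem hy]
    rfl) l
  exact (h1.contMDiffAt ((x.coord.open_source.inter (s.isOpen_dom m)).mem_nhds
    ⟨hm, s.mem_dom m⟩)).mdifferentiableAt (by simp)

lemma diffField_e (η : BGLift s x) (hm : m ∈ x.coord.source) (i : Fin n) : DiffField (x.e i) m := by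
  obtain ⟨h, hh⟩ := η.exists_isDiffSection hm
  exact (hh.diffField_frameField i).congr (η.frameField_sec_eventually hm i)

/-- The matrix square root need not be differentiated: row `i` of `B` consists of the coordinate
coefficients of `e_i`, which belongs to the frame of a differentiable spin section. -/
lemma diffFun_B (η : BGLift s x) (hm : m ∈ x.coord.source) (i j : Fin n) :
    DiffFun (n := n) (fun y => x.B y i j) m :=
  x.diffFun_coefficient hm (η.diffField_e hm i) (b := fun y => x.B y i) (fun _ _ => rfl) j

lemma Γt_eq (η : BGLift s x) (hm : m ∈ x.coord.source) (i j k : Fin n) :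
    x.Γt i j k m = koszul g (frameField s η.sec i) (frameField s η.sec j)
      (frameField s η.sec k) m :=
  koszul_congr (η.frameField_sec_eventually hm i) (η.frameField_sec_eventually hm j)
    (η.frameField_sec_eventually hm k)

lemma Γt_antisymm (η : BGLift s x) (hm : m ∈ x.coord.source) (i j k : Fin n) :
    x.Γt i j k m = -x.Γt i k j m := by
  rw [η.Γt_eq hm, η.Γt_eq hm, eq_neg_iff_add_eq_zero, koszul_add_koszul_swap]
  simp only [inner_frameField]
  rw [mvfderiv_const]
  rfl

lemma inner_e (η : BGLift s x) (hm : m ∈ x.coord.source) (i j : Fin n) :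
    g.inner m (x.e i m) (x.e j m) = if i = j then 1 else 0 := by
  rw [← η.frameField_sec hm, ← η.frameField_sec hm, inner_frameField]

/-- Substituting `e_i = ∑ b_i^l ∂_l` into `g(e_i, e_k) = δ_{ik}` exhibits this matrix as a right
inverse of `B`. -/
lemma inner_partialField_e (η : BGLift s x) (hm : m ∈ x.coord.source) (l k : Fin n) :
    g.inner m (x.partialField l m) (x.e k m) = (x.B m)⁻¹ l k := by
  have h : x.B m * Matrix.of (fun l k => g.inner m (x.partialField l m) (x.e k m)) = 1 := by
    ext i k
    rw [Matrix.one_apply, ← η.inner_e hm i k, Matrix.mul_apply]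
    conv_rhs => rw [NormalCoordinates.e, map_sum, sum_apply]
    simp
  rw [Matrix.inv_eq_right_inv h]
  rfl

/-- Since the coordinate fields commute, only derivatives of the coefficients survive. -/
lemma mlieBracket_e (η : BGLift s x) (hm : m ∈ x.coord.source) (i j : Fin n) :
    VectorField.mlieBracket 𝓘(ℝ, Euc n) (x.e i) (x.e j) m
      = (∑ l, mvfderiv 𝓘(ℝ, Euc n) (fun y => x.B y j l) m (x.e i m) • x.partialField l m)
        - ∑ l, mvfderiv 𝓘(ℝ, Euc n) (fun y => x.B y i l) m (x.e j m) • x.partialField l m := by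
  have hp := fun l => x.diffField_partialField hm l
  have h1 : ∀ l, VectorField.mlieBracket 𝓘(ℝ, Euc n) (x.e i) (x.partialField l) m
      = -∑ r, mvfderiv 𝓘(ℝ, Euc n) (fun y => x.B y i r) m (x.partialField l m) •
        x.partialField r m := by
    intro l
    refine (mlieBracket_sum_left (x.partialField l) Finset.univ hp (η.diffFun_B hm i)).trans ?_
    rw [← Finset.sum_neg_distrib]
    refine Finset.sum_congr rfl fun r _ => ?_
    rw [x.mlieBracket_partialField hm, smul_zero, zero_sub]
  refine (mlieBracket_sum_right (x.e i) Finset.univ hp (η.diffFun_B hm j)).trans ?_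
  rw [Finset.sum_add_distrib, add_comm, sub_eq_add_neg]
  congr 1
  simp_rw [h1, smul_neg, Finset.sum_neg_distrib, Finset.smul_sum]
  rw [Finset.sum_comm]
  congr 1
  refine Finset.sum_congr rfl fun r _ => ?_
  conv_rhs => rw [NormalCoordinates.e, map_sum, Finset.sum_smul]
  refine Finset.sum_congr rfl fun l _ => ?_
  rw [map_smul, smul_smul, smul_eq_mul]

/-- Torsion-freeness turns the left side into `g([e_i, e_j], e_k)`. The coefficients of `W` enter
here, and only through their antisymmetrization in `i, j`. -/
lemma Γt_sub_swap (η : BGLift s x) (hm : m ∈ x.coord.source) (i j k : Fin n) :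
    x.Γt i j k m - x.Γt j i k m
      = (∑ r, ∑ l, x.B m i r * x.partialDeriv r (fun y => x.B y j l) m * (x.B m)⁻¹ l k)
        - ∑ r, ∑ l, x.B m j r * x.partialDeriv r (fun y => x.B y i l) m * (x.B m)⁻¹ l k := by
  have h : ∀ i j, g.inner m (∑ l, mvfderiv 𝓘(ℝ, Euc n) (fun y => x.B y j l) m (x.e i m) •
        x.partialField l m) (x.e k m)
      = ∑ r, ∑ l, x.B m i r * x.partialDeriv r (fun y => x.B y j l) m * (x.B m)⁻¹ l k := by
    intro i j
    rw [map_sum, sum_apply, Finset.sum_comm]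
    refine Finset.sum_congr rfl fun l _ => ?_
    rw [map_smul, smul_apply, η.inner_partialField_e hm, ← Finset.sum_mul, smul_eq_mul]
    congr 1
    conv_lhs => rw [NormalCoordinates.e, map_sum]
    refine Finset.sum_congr rfl fun r _ => ?_
    rw [map_smul]
    rfl
  have h1 := koszul_sub_koszul_swap g (x.e i) (x.e j) (x.e k) m
  rw [η.mlieBracket_e hm, map_sub, sub_apply, h, h] at h1
  exact h1

lemma bar_mk (η : BGLift s x) (hm : m ∈ x.coord.source) {ψ : SpinorField (flatSpin n) ρ} {φ : S}
    (hφ : ψ (x.coord m) = Spinor.mk (flatSpin n) ρ (flatSec n (x.coord m)) φ) :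
    η.bar ρ ψ m = Spinor.mk s ρ (η.sec m) φ := by
  rw [bar, dif_pos hm, hφ, η.sec_of_mem hm]
  rfl

lemma component_bar (η : BGLift s x) (hm : m ∈ x.coord.source) (ψ : SpinorField (flatSpin n) ρ) :
    component s ρ η.sec (η.bar ρ ψ) m
      = component (flatSpin n) ρ (flatSec n) ψ (x.coord m) := by
  rw [component_eq_iff]
  exact η.bar_mk hm (mk_component _ _ _).symm

lemma cliffordAction_W (η : BGLift s x) (hm : m ∈ x.coord.source) (φ : S) :
    cliffordAction s ρ m (x.W m) (Spinor.mk s ρ (η.sec m) φ)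
      = Spinor.mk s ρ (η.sec m) (ρ.bilin ((1 / 4 : ℝ) • ∑ i, ∑ j, ∑ k,
        if i ≠ j ∧ j ≠ k ∧ i ≠ k then
          (∑ r, ∑ l, x.B m i r * x.partialDeriv r (fun m' => x.B m' j l) m * (x.B m)⁻¹ l k) •
            (gen i * gen j * gen k) else 0) φ) := by
  have hι : ∀ (v : Tan n m), cliffordAction s ρ m (CliffordAlgebra.ι (tanForm g m) v)
      = cliffordMul s ρ m v := fun v => CliffordAlgebra.lift_ι_apply _ _ _
  have hmul : ∀ i (χ : S), cliffordMul s ρ m (x.e i m) (Spinor.mk s ρ (η.sec m) χ)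
      = Spinor.mk s ρ (η.sec m) (ρ.bilin (gen i) χ) := by
    intro i χ
    rw [← η.frameField_sec hm, cliffordMul_frameField]
  simp only [NormalCoordinates.W, map_smul, map_sum, LinearMap.smul_apply, LinearMap.sum_apply,
    mk_smul, mk_sum]
  congr 1
  refine Finset.sum_congr rfl fun i _ => Finset.sum_congr rfl fun j _ =>
    Finset.sum_congr rfl fun k _ => ?_
  split_ifs with h
  · simp only [map_smul, map_mul, LinearMap.smul_apply, Module.End.mul_apply, hι, hmul, mk_smul,
      ρ.bilin_mul]
  · simp only [map_zero, LinearMap.zero_apply]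
    exact (map_zero (Spinor.linEquiv s ρ (η.sec m))).symm

lemma cliffordMul_V (η : BGLift s x) (hm : m ∈ x.coord.source) (φ : S) :
    cliffordMul s ρ m (x.V m) (Spinor.mk s ρ (η.sec m) φ)
      = Spinor.mk s ρ (η.sec m) (ρ.bilin ((1 / 4 : ℝ) • ∑ i, ∑ k,
        (x.Γt i k i m - x.Γt i i k m) • gen k) φ) := by
  simp only [NormalCoordinates.V, map_smul, map_sum, LinearMap.smul_apply, LinearMap.sum_apply,
    mk_smul, mk_sum, ← η.frameField_sec hm, cliffordMul_frameField]

lemma V_eq (η : BGLift s x) (hm : m ∈ x.coord.source) :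
    x.V m = (1 / 2 : ℝ) • ∑ i, ∑ k, x.Γt i k i m • x.e k m := by
  simp only [NormalCoordinates.V, Finset.smul_sum, smul_smul]
  refine Finset.sum_congr rfl fun i _ => Finset.sum_congr rfl fun k _ => ?_
  rw [η.Γt_antisymm hm i i k]
  congr 1
  ring

/-- The cubic splitting applied to `Γ̃`, with the coefficients of `W` as `T`: this is the whole
zeroth order part of the Dirac operator. -/
lemma sum_gen_mul_bivec (η : BGLift s x) (hm : m ∈ x.coord.source) :
    ∑ i, gen i * bivec (fun j k => x.Γt i j k m)
      = ((1 / 4 : ℝ) • ∑ i, ∑ j, ∑ k, if i ≠ j ∧ j ≠ k ∧ i ≠ k then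
          (∑ r, ∑ l, x.B m i r * x.partialDeriv r (fun m' => x.B m' j l) m * (x.B m)⁻¹ l k) •
            (gen i * gen j * gen k) else 0)
        + (1 / 4 : ℝ) • ∑ i, ∑ k, (x.Γt i k i m - x.Γt i i k m) • gen k := by
  rw [← smul_add, ← sum_smul_gen_mul_gen_mul_gen (fun i j k => x.Γt i j k m) _
    (η.Γt_antisymm hm) (η.Γt_sub_swap hm)]
  simp only [bivec, mul_smul_comm, Finset.mul_sum, Finset.smul_sum]

lemma nablaComponent_bar (η : BGLift s x) [FiniteDimensional ℂ S] (hm : m ∈ x.coord.source)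
    {ψ : SpinorField (flatSpin n) ρ}
    (hψ : MDifferentiableAt 𝓘(ℝ, Euc n) 𝓘(ℝ, S) (component (flatSpin n) ρ (flatSec n) ψ)
      (x.coord m)) :
    MDifferentiableAt 𝓘(ℝ, Euc n) 𝓘(ℝ, S) (component s ρ η.sec (η.bar ρ ψ)) m ∧
    ∀ i, nablaComponent ρ η.sec (frameField s η.sec i) (η.bar ρ ψ) m
      = (∑ j, x.B m i j • mvfderiv 𝓘(ℝ, Euc n) (component (flatSpin n) ρ (flatSec n) ψ)
          (x.coord m) (stdVec j))
        + ρ.bilin (bivec fun j k => x.Γt i j k m)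
          (component (flatSpin n) ρ (flatSec n) ψ (x.coord m)) := by
  set φ := component (flatSpin n) ρ (flatSec n) ψ
  have hc := (x.contMDiffAt_coord hm).mdifferentiableAt (by simp)
  have hev : component s ρ η.sec (η.bar ρ ψ) =ᶠ[𝓝 m] φ ∘ x.coord := by
    filter_upwards [x.coord.open_source.mem_nhds hm] with y hy
    exact η.component_bar hy ψ
  refine ⟨(hψ.comp m hc).congr_of_eventuallyEq hev, fun i => ?_⟩
  rw [nablaComponent, η.component_bar hm, η.frameField_sec hm]
  congr 1
  · have h1 : mvfderiv 𝓘(ℝ, Euc n) (component s ρ η.sec (η.bar ρ ψ)) m (x.e i m)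
        = mvfderiv 𝓘(ℝ, Euc n) φ (x.coord m)
          (mfderiv 𝓘(ℝ, Euc n) 𝓘(ℝ, Euc n) x.coord m (x.e i m)) := by
      simp only [mvfderiv, ContinuousLinearMap.comp_apply, hev.mfderiv_eq]
      rw [mfderiv_comp m hψ hc]
      rfl
    rw [h1, NormalCoordinates.e, map_sum, map_sum]
    refine Finset.sum_congr rfl fun j _ => ?_
    rw [map_smul, map_smul, x.mfderiv_coord_partialField hm]
  · simp only [η.Γt_eq hm, φ]

end BGLift

end BG

end SpinGeometry

end

/-! ### The formula for the Dirac operator. -/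

open SpinGeometry in
theorem proposition3p1 {n : ℕ} {M : Type*} [TopologicalSpace M] [T2Space M]
    [ChartedSpace (Euc n) M] [IsManifold 𝓘(ℝ, Euc n) ∞ M]
    (g : Metric n M) (o : OrientationField n M) (s : SpinStructure g o)
    {S : Type*} [NormedAddCommGroup S] [NormedSpace ℂ S] [FiniteDimensional ℂ S]
    (ρ : SpinorModule n S) (p : M) (x : NormalCoordinates g o p) (η : BGLift s x)
    (ψ : SpinorField (flatSpin n) ρ) (hψ : SmoothSpinorOn (flatSpin n) ρ ψ x.coord.target) :
    ∀ m ∈ x.coord.source,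
      dirac s ρ (η.bar ρ ψ) m
          = η.bar ρ (dirac (flatSpin n) ρ ψ) m
            + cliffordAction s ρ m (x.W m) (η.bar ρ ψ m)
            + cliffordMul s ρ m (x.V m) (η.bar ρ ψ m)
            + ∑ i, ∑ j, (x.B m i j - if i = j then 1 else 0) •
                η.bar ρ (fun y => cliffordMul (flatSpin n) ρ y (stdVec i)
                  (spinorNabla (flatSpin n) ρ (constField (stdVec j)) ψ y)) m
        ∧ x.V m = (1 / 2 : ℝ) • ∑ i, ∑ k, x.Γt i k i m • x.e k m := by
  intro m hm
  refine ⟨?_, η.V_eq hm⟩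
  set φ := component (flatSpin n) ρ (flatSec n) ψ with hφ
  have hd : MDifferentiableAt 𝓘(ℝ, Euc n) 𝓘(ℝ, S) φ (x.coord m) := by
    -- Any base point serves: the preferred flat sections are all the constant section on the whole
    -- space.
    have h1 := (hψ 0).mdifferentiableOn (by simp)
    refine (h1 (x.coord m) ⟨x.coord.map_source hm, trivial⟩).mdifferentiableAt ?_
    exact (x.coord.open_target.inter isOpen_univ).mem_nhds ⟨x.coord.map_source hm, trivial⟩
  obtain ⟨h, hh⟩ := η.exists_isDiffSection hm
  obtain ⟨hdiff, hnabla⟩ := η.nablaComponent_bar hm hd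
  have hbar : η.bar ρ ψ m = Spinor.mk s ρ (η.sec m) (φ (x.coord m)) :=
    η.bar_mk hm (mk_component _ _ _).symm
  have hbar' : ∀ i j, η.bar ρ (fun y => cliffordMul (flatSpin n) ρ y (stdVec i)
        (spinorNabla (flatSpin n) ρ (constField (stdVec j)) ψ y)) m
      = Spinor.mk s ρ (η.sec m)
        (ρ.bilin (gen i) (mvfderiv 𝓘(ℝ, Euc n) φ (x.coord m) (stdVec j))) :=
    fun i j => η.bar_mk hm (by rw [spinorNabla_flat, cliffordMul_flat])
  rw [hh.dirac_eq hdiff, hbar, η.cliffordAction_W hm, η.cliffordMul_V hm,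
    η.bar_mk hm (dirac_flat ψ (x.coord m))]
  -- All terms are classes over the same point `η.sec m` of the spin fibre, so an identity in `S`
  -- remains.
  simp only [hbar', ← mk_smul, ← mk_sum, ← mk_add]
  congr 1
  rw [add_assoc (∑ i, _) (ρ.bilin _ _), ← LinearMap.add_apply, ← map_add, ← η.sum_gen_mul_bivec hm]
  simp only [hnabla, ← hφ, map_add, map_sum, map_smul, LinearMap.sum_apply, ρ.bilin_mul,
    Finset.sum_add_distrib, sub_smul, Finset.sum_sub_distrib, ite_smul, one_smul, zero_smul,
    Finset.sum_ite_eq, Finset.mem_univ, if_true]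
  abel
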